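/- **Conventions.** A partial commutative monoid (PCM) is a set with an element $0$ and a partial binary operation $\ovee$ that is commutative, associative and has unit $0$ (in the sense of Kleene equality); $x\perp y$ means that $x\ovee y$ is defined. An effect algebra is a PCM with an element $1$ such that every $x$ has a unique $x^\perp$ with $x\ovee x^\perp=1$, and $x\perp 1$ implies $x=0$; it is ordered by $x\le y\iff\exists z,\ x\ovee z=y$. It is convex if it carries an action of $[0,1]\subseteq\mathbb R$ with $\lambda(\mu x)=(\lambda\mu)x$, $1x=x$, $\lambda x\ovee\mu x=(\lambda+\mu)x$ if $\lambda+\mu\le1$, and $\lambda(x\ovee y)=\lambda x\ovee\lambda y$ if $x\perp y$. It is directed complete if every upwards directed subset has a supremum. An *effectus* is a category $\mathbf C$ with finite coproducts, enriched over PCMs (composition is biadditive), such that: two maps $f,g\colon A\to B$ that are the two partial projections of one map $A\to B+B$ are summable; if $f\perp g$ then $\kappa_1\circ f\perp\kappa_2\circ g$; and there is a distinguished object $I$ such that each $\mathrm{Pred}(A):=\mathbf C(A,I)$ is an effect algebra with top $\mathbf 1_A$, $\mathbf 1_B\circ f=0$ implies $f=0$, and $\mathbf 1_B\circ f\perp\mathbf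 1_B\circ g$ implies $f\perp g$ (for $f,g\colon A\to B$). Elements of $\mathrm{Pred}(A)$ are predicates, maps $I\to I$ are scalars, and a state on $A$ is a map $\omega\colon I\to A$ with $\mathbf 1_A\circ\omega=\mathbf 1_I$. The effectus is *normal* if every $\mathrm{Pred}(A)$ is directed complete and, for every map $f\colon A\to B$, $p\mapsto p\circ f$ preserves directed suprema. It is *separated by states* if maps $f,g\colon A\to B$ with $f\circ\omega=g\circ\omega$ for all states $\omega$ on $A$ are equal. A *comprehension* of $p\in\mathrm{Pred}(A)$ is a map $\pi\colon X\to A$ with $\mathbf 1\circ\pi=p\circ\pi$ through which every $f\colon B\to A$ with $\mathbf 1\circ f=p\circ f$ factors uniquely. A *filter* of $p$ is a map $\xi\colon A\to X$ with $\mathbf 1\circ\xi\le p$ through which every $f\colon A\to B$ with $\mathbf 1\circ f\le p$ factors uniquely. The *image* $\operatorname{im}f$ of $f\colon A\to B$, if it exists, is the least $p\in\mathrm{Pred}(B)$ with $p\circ f=\mathbf 1\circ f$. A predicate is *sharp* if it is the image of some map. Put $\lfloor p\rfloor:=\operatorname{im}\pi_p$ for a comprehension $\pi_p$ of $p$, $\lceil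 p\rceil:=\lfloor p^\perp\rfloor^\perp$, and, for sharp predicates $p$, $f^\diamond(p):=\lceil p\circ f\rceil$ and $f_\diamond(p):=\operatorname{im}(f\circ\pi_p)$. Maps $f\colon A\to B$ and $g\colon B\to A$ are *$\diamond$-adjoint* if $f^\diamond=g_\diamond$. A map is *pure* if it is of the form $\pi\circ\xi$ with $\xi$ a filter and $\pi$ a comprehension (of possibly different predicates). A *sequential effectus* is a normal effectus separated by states in which: 1. every predicate has a filter and a comprehension; 2. every comprehension has an image; 3. the pure maps form a category with a dagger, that is, they contain the identities, are closed under composition, and each pure $f\colon A\to B$ has a pure $f^\dagger\colon B\to A$ with $f^{\dagger\dagger}=f$ and $(f\circ g)^\dagger=g^\dagger\circ f^\dagger$; 4. every pure $f$ is $\diamond$-adjoint to $f^\dagger$; 5. for every $p\in\mathrm{Pred}(A)$ there is a unique map $\mathrm{asrt}_p\colon A\to A$ of the form $g\circ g^\dagger$ with $g$ pure such that $\mathbf 1\circ\mathrm{asrt}_p=p$; 6. for every $A$ the operation $p\mathbin{\&}q:=q\circ\mathrm{asrt}_p$ makes $\mathrm{Pred}(A)$ a normal sequential effect algebra. That is,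 writing $a\mid b$ for $a\mathbin{\&}b=b\mathbin{\&}a$: $a\mathbin{\&}(b\ovee c)=a\mathbin{\&}b\ovee a\mathbin{\&}c$ if $b\perp c$; $1\mathbin{\&}a=a$; $a\mathbin{\&}b=0$ implies $b\mathbin{\&}a=0$; $a\mid b$ implies $a\mid b^\perp$ and $a\mathbin{\&}(b\mathbin{\&}c)=(a\mathbin{\&}b)\mathbin{\&}c$ for all $c$; $c\mid a$ and $c\mid b$ imply $c\mid a\mathbin{\&}b$ and, if $a\perp b$, also $c\mid a\ovee b$; $\mathrm{Pred}(A)$ is directed complete; and for directed $S$ one has $a\mathbin{\&}\bigvee S=\bigvee_{s\in S}a\mathbin{\&}s$, and $a\mid\bigvee S$ if $a\mid s$ for all $s\in S$. An *order unit space* is an ordered real vector space $V$ with an order unit $1$ such that $\|v\|=\inf\{\lambda\ge0 : -\lambda1\le v\le\lambda1\}$ is a norm in which the positive cone is closed. A bounded linear map $\delta\colon V\to V$ is an *order derivation* if for every $t\in\mathbb R$ the series $e^{t\delta}=\sum_n (t\delta)^n/n!$ converges in operator norm and is an order isomorphism of $V$. **Proposition.** Let $\mathbf C$ be a sequential effectus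 with convex scalars, i.e. $\mathrm{Pred}(I)$ is a convex effect algebra, and let $A$ be an object of $\mathbf C$. Equip $\mathrm{Pred}(A)$ with the action $\lambda\cdot p:=(\lambda\cdot\mathbf 1_I)\circ p$ of $[0,1]$. Then there is an order unit space $V_A$ with an isomorphism of convex effect algebras $\mathrm{Pred}(A)\cong[0,1]_{V_A}$. For every such $V_A$ and isomorphism, and every sharp $p\in\mathrm{Pred}(A)$, the maps $q\mapsto q\circ\mathrm{asrt}_p$ and $q\mapsto q\circ\mathrm{asrt}_{p^\perp}$ on $\mathrm{Pred}(A)\cong[0,1]_{V_A}$ extend uniquely to bounded linear maps on $V_A$, again written $\mathrm{asrt}_p$ and $\mathrm{asrt}_{p^\perp}$, and $$D_p:=\mathrm{asrt}_p-\mathrm{asrt}_{p^\perp}$$ is an order derivation on $V_A$. -/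

import Mathlib

open CategoryTheory CategoryTheory.Limits

universe w v u

namespace SeqEff

/-! ### Partial commutative monoids and effect algebras -/

/-- A partial commutative monoid. The partial sum `x ⊕ y` is `some z` when it is defined with value
`z`, and `none` when it is undefined; the equations are Kleene equalities. -/
class PCM (M : Type*) extends Zero M where
  ovee : M → M → Option M
  ovee_comm : ∀ x y, ovee x y = ovee y x
  ovee_assoc : ∀ x y z,
    (ovee x y).bind (fun s => ovee s z) = (ovee y z).bind (fun s => ovee x s)
  zero_ovee : ∀ x, ovee 0 x = some x

/-- The sum of `x` and `y` is defined. -/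
def Perp {M : Type*} [PCM M] (x y : M) : Prop := ∃ z, PCM.ovee x y = some z

/-- The algebraic (pre)order `x ≤ y ↔ ∃ z, x ⊕ z = y`. -/
instance instLEPCM (M : Type*) [PCM M] : LE M := ⟨fun x y => ∃ z, PCM.ovee x z = some y⟩

/-- The PCM `E` is an effect algebra with top element `top`. -/
structure IsEffectAlgebra {E : Type*} [PCM E] (top : E) : Prop where
  existsUnique_ortho : ∀ x : E, ∃! y : E, PCM.ovee x y = some top
  eq_zero_of_perp_top : ∀ x : E, Perp x top → x = 0

/-- The orthosupplement: the element `y` with `x ⊕ y = top`. -/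
noncomputable def IsEffectAlgebra.ortho {E : Type*} [PCM E] {top : E} (h : IsEffectAlgebra top)
    (x : E) : E := (h.existsUnique_ortho x).choose

/-- Every upwards directed subset has a supremum. -/
def IsDirectedComplete (E : Type*) [LE E] : Prop :=
  ∀ U : Set E, DirectedOn (· ≤ ·) U → ∃ s, IsLUB U s

/-- An action of the real unit interval making `E` a convex effect algebra. -/
structure ConvexAction (E : Type*) [PCM E] where
  act : unitInterval → E → E
  act_act : ∀ r s x, act r (act s x) = act (r * s) x
  add_act : ∀ (r s t : unitInterval) (x : E), (r : ℝ) + s = t →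
    PCM.ovee (act r x) (act s x) = some (act t x)
  one_act : ∀ x, act 1 x = x
  act_ovee : ∀ (r : unitInterval) (x y z : E), PCM.ovee x y = some z →
    PCM.ovee (act r x) (act r y) = some (act r z)

/-- `seq` is a normal sequential product on the effect algebra `E`. -/
structure IsNormalSequentialProduct {E : Type*} [PCM E] {top : E} (h : IsEffectAlgebra top)
    (seq : E → E → E) : Prop where
  seq_ovee : ∀ a b c d, PCM.ovee b c = some d → PCM.ovee (seq a b) (seq a c) = some (seq a d)
  top_seq : ∀ a, seq top a = a
  seq_eq_zero : ∀ a b, seq a b = 0 → seq b a = 0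
  commute_ortho : ∀ a b, seq a b = seq b a → seq a (h.ortho b) = seq (h.ortho b) a
  seq_assoc : ∀ a b, seq a b = seq b a → ∀ c, seq a (seq b c) = seq (seq a b) c
  commute_seq : ∀ a b c, seq c a = seq a c → seq c b = seq b c →
    seq c (seq a b) = seq (seq a b) c
  commute_ovee : ∀ a b c d, seq c a = seq a c → seq c b = seq b c → PCM.ovee a b = some d →
    seq c d = seq d c
  directedComplete : IsDirectedComplete E
  seq_sup : ∀ (a : E) (S : Set E) (s : E), DirectedOn (· ≤ ·) S → IsLUB S s →
    IsLUB (seq a '' S) (seq a s)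
  commute_sup : ∀ (a : E) (S : Set E) (s : E), DirectedOn (· ≤ ·) S → IsLUB S s →
    (∀ x ∈ S, seq a x = seq x a) → seq a s = seq s a

/-! ### Effectuses in partial form -/

/-- A category with finite coproducts that is enriched over PCMs and satisfies the compatible sum
and untying axioms (a finitely partially additive category). Composition is in diagrammatic
order: `f ≫ g` is `g ∘ f`. -/
class FinPAC (C : Type u) [Category.{v} C] [HasFiniteCoproducts C] where
  homPCM : ∀ A B : C, PCM (A ⟶ B)
  comp_zero : ∀ {A B D : C} (f : A ⟶ B), f ≫ (0 : B ⟶ D) = 0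
  zero_comp : ∀ {A B D : C} (f : B ⟶ D), (0 : A ⟶ B) ≫ f = 0
  comp_ovee : ∀ {A B D : C} (f : A ⟶ B) (g h k : B ⟶ D), PCM.ovee g h = some k →
    PCM.ovee (f ≫ g) (f ≫ h) = some (f ≫ k)
  ovee_comp : ∀ {A B D : C} (f g h : A ⟶ B) (k : B ⟶ D), PCM.ovee f g = some h →
    PCM.ovee (f ≫ k) (g ≫ k) = some (h ≫ k)
  /-- Maps `f, g` that are the two partial projections of one map into `B ⨿ B` are summable. -/
  compatible_sum : ∀ {A B : C} (f g : A ⟶ B) (h : A ⟶ B ⨿ B),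
    h ≫ coprod.desc (𝟙 B) 0 = f → h ≫ coprod.desc 0 (𝟙 B) = g → Perp f g
  untying : ∀ {A B : C} (f g : A ⟶ B), Perp f g →
    Perp (f ≫ (coprod.inl : B ⟶ B ⨿ B)) (g ≫ (coprod.inr : B ⟶ B ⨿ B))

attribute [reducible, instance] FinPAC.homPCM

/-- An effectus in partial form, with unit object `unit`, and `truth A` the top predicate on `A`. -/
class Effectus (C : Type u) [Category.{v} C] [HasFiniteCoproducts C] extends FinPAC C where
  unit : C
  truth : ∀ A : C, A ⟶ unit
  isEffectAlgebra : ∀ A : C, IsEffectAlgebra (truth A)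
  eq_zero_of_truth : ∀ {A B : C} (f : A ⟶ B), f ≫ truth B = 0 → f = 0
  perp_of_truth : ∀ {A B : C} (f g : A ⟶ B), Perp (f ≫ truth B) (g ≫ truth B) → Perp f g

variable {C : Type u} [Category.{v} C] [HasFiniteCoproducts C] [Effectus C]

/-- Predicates on `A`. -/
abbrev Pred (A : C) := A ⟶ Effectus.unit (C := C)

/-- The top predicate. -/
abbrev truth (A : C) : Pred A := Effectus.truth A

/-- The orthosupplement of a predicate. -/
noncomputable def ortho {A : C} (p : Pred A) : Pred A := (Effectus.isEffectAlgebra A).ortho p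

/-- Total maps. -/
def IsTotal {A B : C} (f : A ⟶ B) : Prop := f ≫ truth B = truth A

variable (C) in
/-- Predicate spaces are directed complete and all maps are Scott continuous. -/
structure IsNormalEffectus : Prop where
  directedComplete : ∀ A : C, IsDirectedComplete (Pred A)
  scott : ∀ {A B : C} (f : A ⟶ B) (U : Set (Pred B)) (s : Pred B), DirectedOn (· ≤ ·) U →
    IsLUB U s → IsLUB ((fun p : Pred B => (f ≫ p : Pred A)) '' U) (f ≫ s)

variable (C) in
/-- Maps are determined by their values on states, i.e. on total maps from the unit object. -/
def IsSeparatedByStates : Prop :=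
  ∀ {A B : C} (f g : A ⟶ B),
    (∀ ω : Effectus.unit (C := C) ⟶ A, IsTotal ω → ω ≫ f = ω ≫ g) → f = g

/-- `π : X ⟶ A` is a comprehension for the predicate `p` on `A`. -/
structure IsComprehension {A X : C} (p : Pred A) (π : X ⟶ A) : Prop where
  truth_eq : π ≫ truth A = π ≫ p
  final : ∀ {B : C} (f : B ⟶ A), f ≫ truth A = f ≫ p → ∃! g : B ⟶ X, g ≫ π = f

/-- `ξ : A ⟶ X` is a filter for the predicate `p` on `A`. -/
structure IsFilter {A X : C} (p : Pred A) (ξ : A ⟶ X) : Prop where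
  truth_le : (ξ ≫ truth X : Pred A) ≤ p
  initial : ∀ {B : C} (f : A ⟶ B), (f ≫ truth B : Pred A) ≤ p → ∃! g : X ⟶ B, ξ ≫ g = f

/-- The predicate `p` is the image of `f`: the least predicate with `p ∘ f = 1 ∘ f`. -/
structure IsImage {A B : C} (f : A ⟶ B) (p : Pred B) : Prop where
  comp_eq : f ≫ p = f ≫ truth B
  least : ∀ q : Pred B, f ≫ q = f ≫ truth B → p ≤ q

/-- Sharp predicates are the images of maps. -/
def IsSharp {A : C} (p : Pred A) : Prop := ∃ (B : C) (f : B ⟶ A), IsImage f p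

/-- `r` is the floor of `p`, the image of a comprehension of `p`. -/
def IsFloor {A : C} (p r : Pred A) : Prop :=
  ∃ (X : C) (π : X ⟶ A), IsComprehension p π ∧ IsImage π r

/-- `r` is the ceiling of `p`, the De Morgan dual of the floor. -/
def IsCeil {A : C} (p r : Pred A) : Prop := IsFloor (ortho p) (ortho r)

/-- `r = f^◇(p) = ⌈p ∘ f⌉`. -/
def IsDiamondUpper {A B : C} (f : A ⟶ B) (p : Pred B) (r : Pred A) : Prop := IsCeil (f ≫ p) r

/-- `r = f_◇(p)`, the image of `f ∘ π_p` for a comprehension `π_p` of `p`. -/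
def IsDiamondLower {A B : C} (f : A ⟶ B) (p : Pred A) (r : Pred B) : Prop :=
  ∃ (X : C) (π : X ⟶ A), IsComprehension p π ∧ IsImage (π ≫ f) r

/-- `f^◇ = g_◇` on sharp predicates. -/
def IsDiamondAdjoint {A B : C} (f : A ⟶ B) (g : B ⟶ A) : Prop :=
  ∀ p : Pred B, IsSharp p → ∀ r : Pred A, IsDiamondUpper f p r ↔ IsDiamondLower g p r

/-- Pure maps: a filter followed by a comprehension. -/
def IsPure {A B : C} (f : A ⟶ B) : Prop :=
  ∃ (X : C) (p : Pred A) (q : Pred B) (ξ : A ⟶ X) (π : X ⟶ B),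
    IsFilter p ξ ∧ IsComprehension q π ∧ f = ξ ≫ π

variable (C) in
/-- The pure maps form a dagger category. -/
structure PureDagger where
  pure_id : ∀ A : C, IsPure (𝟙 A)
  pure_comp : ∀ {A B D : C} {f : A ⟶ B} {g : B ⟶ D}, IsPure f → IsPure g → IsPure (f ≫ g)
  dag : ∀ {A B : C} (f : A ⟶ B), IsPure f → (B ⟶ A)
  pure_dag : ∀ {A B : C} (f : A ⟶ B) (hf : IsPure f), IsPure (dag f hf)
  dag_dag : ∀ {A B : C} (f : A ⟶ B) (hf : IsPure f), dag (dag f hf) (pure_dag f hf) = f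
  dag_comp : ∀ {A B D : C} (f : A ⟶ B) (g : B ⟶ D) (hf : IsPure f) (hg : IsPure g),
    dag (f ≫ g) (pure_comp hf hg) = dag g hg ≫ dag f hf

/-- `f = g ∘ g†` for some pure map `g`. -/
def PureDagger.IsPositive (D : PureDagger C) {A : C} (f : A ⟶ A) : Prop :=
  ∃ (X : C) (g : X ⟶ A) (hg : IsPure g), f = D.dag g hg ≫ g

variable (C) in
/-- A sequential effectus. -/
class SequentialEffectus where
  normal : IsNormalEffectus C
  separated : IsSeparatedByStates C
  hasFilters : ∀ {A : C} (p : Pred A), ∃ (X : C) (ξ : A ⟶ X), IsFilter p ξ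
  hasComprehensions : ∀ {A : C} (p : Pred A), ∃ (X : C) (π : X ⟶ A), IsComprehension p π
  comprehension_image : ∀ {A X : C} (p : Pred A) (π : X ⟶ A), IsComprehension p π →
    ∃ q : Pred A, IsImage π q
  dagger : PureDagger C
  diamond_adjoint : ∀ {A B : C} (f : A ⟶ B) (hf : IsPure f),
    IsDiamondAdjoint f (dagger.dag f hf)
  /-- The assert map of a predicate: the unique `†`-positive pure map `a` with `1 ∘ a = p`. -/
  asrt : ∀ {A : C}, Pred A → (A ⟶ A)
  asrt_positive : ∀ {A : C} (p : Pred A), dagger.IsPositive (asrt p)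
  asrt_truth : ∀ {A : C} (p : Pred A), asrt p ≫ truth A = p
  asrt_unique : ∀ {A : C} (p : Pred A) (a : A ⟶ A), dagger.IsPositive a →
    a ≫ truth A = p → a = asrt p
  sequential : ∀ A : C,
    IsNormalSequentialProduct (Effectus.isEffectAlgebra A) (fun p q : Pred A => asrt p ≫ q)

/-! ### Order unit spaces and order derivations -/

/-- An order unit space, carrying its order unit norm. -/
class OrderUnitSpace (V : Type*) extends NormedAddCommGroup V, NormedSpace ℝ V, PartialOrder V,
    IsOrderedAddMonoid V, PosSMulMono ℝ V where
  ounit : V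
  ounit_nonneg : 0 ≤ ounit
  exists_bound : ∀ x : V, ∃ r : ℝ, 0 ≤ r ∧ -(r • ounit) ≤ x ∧ x ≤ r • ounit
  norm_eq : ∀ x : V, ‖x‖ = sInf {r : ℝ | 0 ≤ r ∧ -(r • ounit) ≤ x ∧ x ≤ r • ounit}
  isClosed_nonneg : IsClosed {x : V | 0 ≤ x}

/-- The bounded linear map `δ` is an order derivation: for all real `t` the series
`∑ (t δ)^n / n!` converges in operator norm to an order isomorphism. -/
def IsOrderDerivation {V : Type*} [OrderUnitSpace V] (δ : V →L[ℝ] V) : Prop :=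
  ∀ t : ℝ, ∃ E : V →L[ℝ] V,
    HasSum (fun n : ℕ => ((n.factorial : ℝ)⁻¹) • (t • δ) ^ n) E ∧
      ∃ e : V ≃o V, ∀ x, e x = E x

/-- `φ` is an isomorphism of convex effect algebras from the predicates on `A` onto the unit
interval of `V`, where `conv` makes the scalars convex and predicates carry the action
`r · p = (r · 1) ∘ p`. -/
structure IsUnitIntervalIso (conv : ConvexAction (Pred (Effectus.unit (C := C)))) (A : C)
    {V : Type*} [OrderUnitSpace V] (φ : Pred A → V) : Prop where
  bijOn : Set.BijOn φ Set.univ (Set.Icc 0 OrderUnitSpace.ounit)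
  map_truth : φ (truth A) = OrderUnitSpace.ounit
  ovee_iff : ∀ p q r : Pred A, PCM.ovee p q = some r ↔ φ p + φ q = φ r
  map_act : ∀ (r : unitInterval) (p : Pred A),
    φ (p ≫ conv.act r (truth Effectus.unit)) = (r : ℝ) • φ p

/-- The bounded linear map `T` on `V` is the action `p ↦ p ∘ f` of the endomap `f` on the
predicates, extended to `V`. -/
def IsInduced {A : C} {V : Type*} [OrderUnitSpace V] (φ : Pred A → V) (f : A ⟶ A)
    (T : V →L[ℝ] V) : Prop := ∀ p : Pred A, T (φ p) = φ (f ≫ p)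

end SeqEff

open SeqEff

/-! The predicates on `A` form a directed complete convex effect algebra. Such an algebra embeds in
an enveloping ordered vector space as a full order interval. Directed completeness makes the unit
Archimedean, so the envelope is an order unit space (`exists_orderUnitSpace`).

For sharp `p` the extensions `P`, `P'` of `asrt_p`, `asrt_{p⊥}` are idempotents with `P P' = P' P =
0`. Hence `exp (t D) = exp t • P + exp (-t) • P' + (1 - P - P')`, with inverse `exp (-t D)`, and
only positivity is at stake. Swapping `p` and `p⊥` reduces to `t > 0`. As `exp (t D) = lim (1 -
(t/n) D)⁻ⁿ`, it suffices that `s D x ≤ x` forces `0 ≤ x` for `0 < s < 1` (`nonneg_of_smul_le`).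

This is a minimum principle. If `x` is not positive, take the least `m > 0` with `0 ≤ x + m 1`, and
a nonzero sharp `f` on which `x + m 1` is nearly zero (`exists_spectral_cut`). Compressing `s D x ≤
x` by `asrt_f` gives a contradiction, provided `D` carries nothing positive from `f⊥` into the
corner of `f`. That is the corner identity `f & (p & z) = f & (p⊥ & z)` for `z ≤ f⊥`
(`sq_sq_eq_of_le_ortho`).

For `z = f⊥` both sides of the corner identity equal `(f & p) & (f & p⊥)`, by `(f & p) & (f & p) = f
& (p & f)`. The latter (`asrt_sq_of_isSharp`) comes from the dagger: `h` followed by `h†` depends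
only on the predicate of the pure map `h`. General `z` follows by `sharp_induction`, because every
nonzero predicate dominates a positive multiple of a nonzero sharp one (`exists_sharp_le`). -/

namespace SeqEff

/-! ### Totalised partial sums -/

/-- Partial elements of `M`: the partial sum becomes a total, commutative and associative one. -/
def PartialSum (M : Type*) := Option M

/-- The inclusion of `M` into its totalisation. -/
def PartialSum.of {M : Type*} (x : M) : PartialSum M := some x

theorem PartialSum.of_injective {M : Type*} : Function.Injective (PartialSum.of (M := M)) :=
  fun _ _ h => Option.some.inj h

section PartialSumMonoid
variable {M : Type*} [PCM M]

instance : Zero (PartialSum M) := ⟨PartialSum.of 0⟩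

instance : Add (PartialSum M) :=
  ⟨fun x y => Option.bind x fun a => Option.bind y fun b => PCM.ovee a b⟩

instance : AddCommMonoid (PartialSum M) where
  add_assoc x y z := by
    change Option.bind (Option.bind x fun a => Option.bind y fun b => PCM.ovee a b)
        (fun a => Option.bind z fun b => PCM.ovee a b) =
      Option.bind x fun a => Option.bind (Option.bind y fun a => Option.bind z fun b =>
        PCM.ovee a b) fun b => PCM.ovee a b
    rcases x with _ | x
    · rfl
    rcases y with _ | y
    · rfl
    rcases z with _ | z
    · simp
    · simpa using PCM.ovee_assoc x y z
  zero_add x := by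
    change (Option.bind x fun b => PCM.ovee 0 b) = x
    rcases x with _ | x
    · rfl
    · simpa using PCM.zero_ovee x
  add_zero x := by
    change (Option.bind x fun a => PCM.ovee a 0) = x
    rcases x with _ | x
    · rfl
    · simpa [PCM.ovee_comm x 0] using PCM.zero_ovee x
  add_comm x y := by
    change (Option.bind x fun a => Option.bind y fun b => PCM.ovee a b) =
      Option.bind y fun a => Option.bind x fun b => PCM.ovee a b
    rcases x with _ | x <;> rcases y with _ | y <;> simp [PCM.ovee_comm]
  nsmul := nsmulRec

namespace PartialSum

theorem of_zero : of (0 : M) = 0 := rfl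

/-- The undefined value is absorbing, so a defined sum has defined summands. -/
theorem exists_of_add {x y : PartialSum M} {z : M} (h : x + y = of z) : ∃ a, x = of a := by
  rcases x with _ | a
  · exact absurd h (by rintro ⟨⟩)
  · exact ⟨a, rfl⟩

theorem le_iff {x y : M} : x ≤ y ↔ ∃ z, of x + of z = of y := Iff.rfl

theorem le_of_add {x y : M} {z : PartialSum M} (h : of x + z = of y) : x ≤ y := by
  obtain ⟨a, rfl⟩ := exists_of_add ((add_comm z (of x)).trans h)
  exact ⟨a, h⟩

end PartialSum

end PartialSumMonoid

/-! ### Cancellation and order in effect algebras -/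

namespace IsEffectAlgebra
open PartialSum
variable {E : Type*} [PCM E] {top : E}

theorem add_ortho (h : IsEffectAlgebra top) (x : E) : of x + of (h.ortho x) = of top :=
  (h.existsUnique_ortho x).choose_spec.1

theorem eq_ortho (h : IsEffectAlgebra top) {x y : E} (hxy : of x + of y = of top) : y = h.ortho x :=
  (h.existsUnique_ortho x).unique hxy (h.add_ortho x)

theorem ortho_ortho (h : IsEffectAlgebra top) (x : E) : h.ortho (h.ortho x) = x :=
  (h.eq_ortho ((add_comm _ _).trans (h.add_ortho x))).symm

theorem le_top (h : IsEffectAlgebra top) (x : E) : x ≤ top := ⟨_, h.add_ortho x⟩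

/-- Both `x` and `y` are orthosupplements of `a` plus the complement of `c`, hence equal. -/
theorem cancel (h : IsEffectAlgebra top) {a : E} {x y : PartialSum E} {c : E} (h1 : of a + x = of c) (h2 : of a + y = of c) :
    x = y := by
  obtain ⟨x, rfl⟩ := exists_of_add ((add_comm _ _).trans h1)
  obtain ⟨y, rfl⟩ := exists_of_add ((add_comm _ _).trans h2)
  have h3 := h.add_ortho c
  have h4 : ∀ z : E, of a + of z = of c → of z + (of a + of (h.ortho c)) = of top := by
    intro z hz
    rw [← add_assoc, add_comm (of z), hz, h3]
  obtain ⟨s, hs⟩ := exists_of_add ((add_comm _ _).trans (h4 x h1))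
  have h5 := h4 x h1
  have h6 := h4 y h2
  rw [hs, add_comm] at h5 h6
  rw [h.eq_ortho h5, h.eq_ortho h6]

theorem eq_zero_of_add (h : IsEffectAlgebra top) {x y : PartialSum E} (hxy : x + y = of 0) : x = of 0 := by
  obtain ⟨a, rfl⟩ := exists_of_add hxy
  have h1 : of top + (of a + y) = of top := by rw [hxy, of_zero, add_zero]
  rw [← add_assoc] at h1
  obtain ⟨b, hb⟩ := exists_of_add h1
  rw [add_comm] at hb
  rw [h.eq_zero_of_perp_top a ⟨b, hb⟩]

theorem le_antisymm (h : IsEffectAlgebra top) {x y : E} (hxy : x ≤ y) (hyx : y ≤ x) : x = y := by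
  obtain ⟨a, ha⟩ := hxy
  obtain ⟨b, hb⟩ := hyx
  have ha : of x + of a = of y := ha
  have hb : of y + of b = of x := hb
  have h1 : of x + (of a + of b) = of x := by rw [← add_assoc, ha, hb]
  have h2 := h.cancel h1 (add_zero _)
  rw [← of_zero] at h2
  have h3 := h.eq_zero_of_add h2
  rw [h3, of_zero, add_zero] at ha
  exact of_injective ha

theorem _root_.SeqEff.pcm_le_trans {x y z : E} (hxy : x ≤ y) (hyz : y ≤ z) : x ≤ z := by
  obtain ⟨a, ha⟩ := hxy
  obtain ⟨b, hb⟩ := hyz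
  have ha : of x + of a = of y := ha
  have hb : of y + of b = of z := hb
  exact le_of_add (z := of a + of b) (by rw [← add_assoc, ha, hb])

theorem _root_.SeqEff.pcm_le_refl (x : E) : x ≤ x := le_of_add (add_zero _)

theorem _root_.SeqEff.pcm_zero_le (x : E) : 0 ≤ x := le_of_add (zero_add _)

theorem eq_zero_of_le_zero (h : IsEffectAlgebra top) {x : E} (hx : x ≤ 0) : x = 0 := h.le_antisymm hx (pcm_zero_le x)

theorem eq_top_of_top_le (h : IsEffectAlgebra top) {x : E} (hx : top ≤ x) : x = top := h.le_antisymm (h.le_top x) hx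

end IsEffectAlgebra

/-! ### Convex effect algebras as unit intervals -/

namespace ConvexAction
open PartialSum
variable {E : Type*} [PCM E] {top : E} (κ : ConvexAction E)

open Classical in
/-- The multiple `r x`, defined for `0 ≤ r ≤ 1`. -/
noncomputable def sm (r : ℝ) (x : E) : PartialSum E :=
  if h : 0 ≤ r ∧ r ≤ 1 then of (κ.act ⟨r, h⟩ x) else none

theorem sm_coe (r : unitInterval) (x : E) : κ.sm r x = of (κ.act r x) := by
  have : (0 : ℝ) ≤ r ∧ (r : ℝ) ≤ 1 := ⟨r.2.1, r.2.2⟩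
  simp [sm, this]

theorem sm_eq {r : ℝ} (h0 : 0 ≤ r) (h1 : r ≤ 1) (x : E) : κ.sm r x = of (κ.act ⟨r, h0, h1⟩ x) :=
  κ.sm_coe ⟨r, h0, h1⟩ x

theorem sm_one (x : E) : κ.sm 1 x = of x := by
  rw [κ.sm_eq zero_le_one le_rfl]
  exact congrArg of (κ.one_act x)

theorem sm_add {r s : ℝ} (hr : 0 ≤ r) (hs : 0 ≤ s) (h : r + s ≤ 1) (x : E) :
    κ.sm (r + s) x = κ.sm r x + κ.sm s x := by
  rw [κ.sm_eq hr (by linarith), κ.sm_eq hs (by linarith), κ.sm_eq (add_nonneg hr hs) h]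
  exact (κ.add_act ⟨r, _⟩ ⟨s, _⟩ ⟨r + s, _⟩ x rfl).symm

theorem sm_of_add {r : ℝ} (h0 : 0 ≤ r) (h1 : r ≤ 1) {x y z : E} (h : of x + of y = of z) :
    κ.sm r x + κ.sm r y = κ.sm r z := by
  rw [κ.sm_eq h0 h1, κ.sm_eq h0 h1, κ.sm_eq h0 h1]
  exact κ.act_ovee _ x y z h

theorem sm_act {r : ℝ} (h0 : 0 ≤ r) (h1 : r ≤ 1) (s : unitInterval) (x : E) :
    κ.sm r (κ.act s x) = κ.sm (r * s) x := by
  rw [κ.sm_eq h0 h1, κ.act_act, κ.sm_eq (mul_nonneg h0 s.2.1)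
    (mul_le_one₀ h1 s.2.1 s.2.2)]
  rfl

theorem nsmul_sm {k : ℕ} {r : ℝ} (h0 : 0 ≤ r) (h1 : k * r ≤ 1) (x : E)
    (hz : κ.sm 0 x = 0) : k • κ.sm r x = κ.sm (k * r) x := by
  induction k with
  | zero => simp [hz]
  | succ k ih =>
    push_cast at h1 ⊢
    rw [succ_nsmul, ih (by linarith), add_mul, one_mul, κ.sm_add (by positivity) h0 (by linarith)]


theorem sm_zero (h : IsEffectAlgebra top) (x : E) : κ.sm 0 x = 0 := by
  have h1 := κ.sm_add le_rfl le_rfl (by norm_num) x (r := 0) (s := 0)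
  rw [add_zero, κ.sm_eq le_rfl zero_le_one] at h1
  rw [κ.sm_eq le_rfl zero_le_one]
  exact h.cancel h1.symm (add_zero _)

/-- The sum is a summand of `(r + s) top`, which is defined. -/
theorem exists_sm_add (h : IsEffectAlgebra top) {r s : ℝ} (hr : 0 ≤ r) (hs : 0 ≤ s) (hrs : r + s ≤ 1) (x y : E) :
    ∃ z, κ.sm r x + κ.sm s y = of z := by
  have h1 := κ.sm_of_add hr (by linarith) (h.add_ortho x)
  have h2 := κ.sm_of_add hs (by linarith) (h.add_ortho y)
  have h3 : (κ.sm r x + κ.sm s y) + (κ.sm r (h.ortho x) + κ.sm s (h.ortho y)) =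
      κ.sm (r + s) top := by
    rw [κ.sm_add hr hs hrs, ← h1, ← h2]
    abel
  rw [κ.sm_eq (by linarith) hrs] at h3
  exact exists_of_add h3

end ConvexAction


/-! ### Order unit spaces from Archimedean order units -/

section OfArchimedean
variable {V : Type*} [AddCommGroup V] [Module ℝ V] [PartialOrder V] [IsOrderedAddMonoid V]
  [PosSMulMono ℝ V]

/-- The order unit norm. -/
noncomputable def orderUnitNorm (e x : V) : ℝ := sInf {r : ℝ | 0 ≤ r ∧ -(r • e) ≤ x ∧ x ≤ r • e}

omit [IsOrderedAddMonoid V] [PosSMulMono ℝ V] in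
theorem orderUnitNorm_nonneg (e x : V) : 0 ≤ orderUnitNorm e x :=
  Real.sInf_nonneg fun _ h => h.1

omit [IsOrderedAddMonoid V] [PosSMulMono ℝ V] in
theorem orderUnitNorm_le {e x : V} {r : ℝ} (h0 : 0 ≤ r) (h1 : -(r • e) ≤ x) (h2 : x ≤ r • e) :
    orderUnitNorm e x ≤ r :=
  csInf_le ⟨0, fun _ h => h.1⟩ ⟨h0, h1, h2⟩

theorem smul_le_smul_unit {e : V} (he : 0 ≤ e) {r s : ℝ} (h : r ≤ s) : r • e ≤ s • e := by
  rw [← sub_nonneg, ← sub_smul]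
  exact smul_nonneg (sub_nonneg.2 h) he

variable {e : V} (he : 0 ≤ e) (hb : ∀ x : V, ∃ r : ℝ, 0 ≤ r ∧ -(r • e) ≤ x ∧ x ≤ r • e)
  (ha : ∀ x : V, (∀ ε : ℝ, 0 < ε → x ≤ ε • e) → x ≤ 0)
include he hb ha

theorem le_orderUnitNorm_smul (x : V) : x ≤ orderUnitNorm e x • e := by
  rw [← sub_nonpos]
  refine ha _ fun ε hε => ?_
  obtain ⟨r, hr, hlt⟩ := exists_lt_of_csInf_lt (hb x) (lt_add_of_pos_right (orderUnitNorm e x) hε)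
  rw [sub_le_iff_le_add, ← add_smul, add_comm ε]
  exact hr.2.2.trans (smul_le_smul_unit he hlt.le)

omit [PosSMulMono ℝ V] he hb ha in
theorem orderUnitNorm_neg (x : V) : orderUnitNorm e (-x) = orderUnitNorm e x := by
  unfold orderUnitNorm
  congr 1
  ext r
  simp only [Set.mem_ofPred_eq, neg_le_neg_iff]
  rw [neg_le (a := x), and_comm (a := x ≤ _)]

theorem neg_orderUnitNorm_smul_le (x : V) : -(orderUnitNorm e x • e) ≤ x := by
  have := le_orderUnitNorm_smul he hb ha (-x)
  rw [orderUnitNorm_neg] at this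
  exact neg_le.1 this

theorem orderUnitNorm_smul_le {c : ℝ} (hc : 0 ≤ c) (x : V) :
    orderUnitNorm e (c • x) ≤ c * orderUnitNorm e x := by
  refine orderUnitNorm_le (mul_nonneg hc (orderUnitNorm_nonneg e x)) ?_ ?_
  · rw [mul_smul, ← smul_neg]
    exact smul_le_smul_of_nonneg_left (neg_orderUnitNorm_smul_le he hb ha x) hc
  · rw [mul_smul]
    exact smul_le_smul_of_nonneg_left (le_orderUnitNorm_smul he hb ha x) hc

theorem orderUnitNorm_smul_of_nonneg {c : ℝ} (hc : 0 ≤ c) (x : V) :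
    orderUnitNorm e (c • x) = c * orderUnitNorm e x := by
  rcases hc.eq_or_lt with rfl | hc
  · refine le_antisymm (orderUnitNorm_smul_le he hb ha le_rfl x) ?_
    rw [zero_mul]
    exact orderUnitNorm_nonneg _ _
  · refine le_antisymm (orderUnitNorm_smul_le he hb ha hc.le x) ?_
    have := orderUnitNorm_smul_le he hb ha (inv_nonneg.2 hc.le) (c • x)
    rw [smul_smul, inv_mul_cancel₀ hc.ne', one_smul] at this
    rwa [← le_inv_mul_iff₀ hc]

theorem orderUnitNorm_core : letI : Norm V := ⟨orderUnitNorm e⟩; NormedSpace.Core ℝ V :=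
  letI : Norm V := ⟨orderUnitNorm e⟩
  { norm_nonneg := orderUnitNorm_nonneg e
    norm_smul := fun c x => by
      change orderUnitNorm e (c • x) = |c| * orderUnitNorm e x
      rcases le_total 0 c with hc | hc
      · rw [abs_of_nonneg hc, orderUnitNorm_smul_of_nonneg he hb ha hc]
      · rw [abs_of_nonpos hc, ← orderUnitNorm_smul_of_nonneg he hb ha (neg_nonneg.2 hc), neg_smul,
          orderUnitNorm_neg]
    norm_triangle := fun x y => by
      refine orderUnitNorm_le (add_nonneg (orderUnitNorm_nonneg e x) (orderUnitNorm_nonneg e y))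
        ?_ ?_
      · rw [add_smul, neg_add]
        exact add_le_add (neg_orderUnitNorm_smul_le he hb ha x)
          (neg_orderUnitNorm_smul_le he hb ha y)
      · rw [add_smul]
        exact add_le_add (le_orderUnitNorm_smul he hb ha x) (le_orderUnitNorm_smul he hb ha y)
    norm_eq_zero_iff := fun x => by
      change orderUnitNorm e x = 0 ↔ x = 0
      constructor
      · intro h
        have h1 := le_orderUnitNorm_smul he hb ha x
        have h2 := neg_orderUnitNorm_smul_le he hb ha x
        rw [h, zero_smul] at h1 h2
        rw [neg_zero] at h2
        exact le_antisymm h1 h2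
      · rintro rfl
        refine le_antisymm (orderUnitNorm_le le_rfl ?_ ?_) (orderUnitNorm_nonneg _ _) <;> simp }

/-- An ordered vector space with an Archimedean order unit is an order unit space. -/
noncomputable abbrev OrderUnitSpace.ofArchimedean : OrderUnitSpace V :=
  letI : Norm V := ⟨orderUnitNorm e⟩
  letI core : NormedSpace.Core ℝ V := orderUnitNorm_core he hb ha
  letI := NormedAddCommGroup.ofCore core
  letI := NormedSpace.ofCore core
  { ounit := e
    ounit_nonneg := he
    exists_bound := hb
    norm_eq := fun _ => rfl
    add_le_add_left := fun _ _ h c => add_le_add_left h c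
    smul_le_smul_of_nonneg_left := fun _ ha _ _ h => smul_le_smul_of_nonneg_left h ha
    isClosed_nonneg := by
      refine isClosed_of_closure_subset fun x hx => ?_
      -- A point `y ≥ 0` within `ε` of `x` gives `-x ≤ y - x ≤ ε e`.
      have h : -x ≤ 0 := ha _ fun ε hε => by
        obtain ⟨y, hy, hxy⟩ := Metric.mem_closure_iff.1 hx ε hε
        rw [dist_comm, dist_eq_norm] at hxy
        have h1 : y - x ≤ ‖y - x‖ • e := le_orderUnitNorm_smul he hb ha (y - x)
        have h2 : -x ≤ y - x := by
          rw [sub_eq_add_neg]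
          exact le_add_of_nonneg_left hy
        exact h2.trans (h1.trans (smul_le_smul_unit he hxy.le))
      exact neg_nonpos.1 h }

end OfArchimedean

/-! ### Ordered quotient of a vector space by a cone -/

section ConeQuotient
variable {G : Type*} [AddCommGroup G] [Module ℝ G]

/-- The ordered vector space generated by a convex cone. -/
def ConeQuotient (C : PointedCone ℝ G) := G ⧸ C.lineal

namespace ConeQuotient
variable (C : PointedCone ℝ G)

noncomputable instance : AddCommGroup (ConeQuotient C) :=
  inferInstanceAs (AddCommGroup (G ⧸ C.lineal))

noncomputable instance : Module ℝ (ConeQuotient C) :=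
  inferInstanceAs (Module ℝ (G ⧸ C.lineal))

/-- The quotient map. -/
noncomputable def mk : G →ₗ[ℝ] ConeQuotient C := C.lineal.mkQ

theorem mk_surjective : Function.Surjective (mk C) := C.lineal.mkQ_surjective

theorem mk_eq_zero {f : G} : mk C f = 0 ↔ f ∈ C ∧ -f ∈ C :=
  Submodule.Quotient.mk_eq_zero C.lineal

noncomputable instance : LE (ConeQuotient C) := ⟨fun x y => ∃ f ∈ C, mk C f = y - x⟩

theorem mk_le_mk {f g : G} : mk C f ≤ mk C g ↔ g - f ∈ C := by
  constructor
  · rintro ⟨k, hk, h⟩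
    rw [← map_sub, ← sub_eq_zero, ← map_sub, mk_eq_zero] at h
    have := C.add_mem hk h.2
    rwa [neg_sub, add_sub_cancel] at this
  · intro h
    exact ⟨_, h, map_sub _ _ _⟩

noncomputable instance : PartialOrder (ConeQuotient C) where
  le_refl x := ⟨0, C.zero_mem, by simp⟩
  le_trans x y z := by
    rintro ⟨f, hf, h1⟩ ⟨g, hg, h2⟩
    exact ⟨f + g, C.add_mem hf hg, by rw [map_add, h1, h2]; abel⟩
  le_antisymm x y := by
    obtain ⟨f, rfl⟩ := mk_surjective C x
    obtain ⟨g, rfl⟩ := mk_surjective C y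
    intro h1 h2
    rw [mk_le_mk] at h1 h2
    rw [← sub_eq_zero, ← map_sub, mk_eq_zero]
    exact ⟨h2, by rwa [neg_sub]⟩

instance : IsOrderedAddMonoid (ConeQuotient C) where
  add_le_add_left x y h z := by
    obtain ⟨f, hf, h⟩ := h
    exact ⟨f, hf, by rw [h]; abel⟩

instance : PosSMulMono ℝ (ConeQuotient C) where
  smul_le_smul_of_nonneg_left c hc x y h := by
    obtain ⟨f, hf, h⟩ := h
    exact ⟨c • f, C.smul_mem hc hf, by
      rw [← smul_sub, ← h]
      exact (mk C).map_smul c f⟩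

end ConeQuotient

end ConeQuotient


/-! ### The enveloping ordered vector space of a convex effect algebra -/

namespace ConvexAction
open PartialSum Filter
variable {E : Type v} [PCM E] {top : E} (κ : ConvexAction E)

/-- Additive relations between formal combinations of elements of a convex effect algebra. -/
inductive Relator : (E →₀ NNReal) → (E →₀ NNReal) → Prop
  | ovee (x y z : E) : of x + of y = of z →
      Relator (Finsupp.single x 1 + Finsupp.single y 1) (Finsupp.single z 1)
  | act (r : unitInterval) (x : E) :
      Relator (Finsupp.single x (Real.toNNReal r)) (Finsupp.single (κ.act r x) 1)

/-- Formal combinations with nonnegative coefficients as formal real combinations. -/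
noncomputable def toRealComb {E : Type*} : (E →₀ NNReal) →ₗ[NNReal] (E →₀ ℝ) :=
  Finsupp.mapRange.linearMap (Algebra.linearMap NNReal ℝ)

theorem toRealComb_injective {E : Type*} : Function.Injective (toRealComb (E := E)) := fun g h H => by
  ext x
  exact DFunLike.congr_fun H x

theorem toRealComb_single {E : Type*} (x : E) (r : NNReal) :
    toRealComb (Finsupp.single x r) = Finsupp.single x (r : ℝ) := by
  simp [toRealComb]

/-- Generators of the positive cone of the enveloping vector space. -/
def coneGenerators : Set (E →₀ ℝ) :=
  {f | (∃ x, f = Finsupp.single x 1) ∨ ∃ g h, (κ.Relator g h ∨ κ.Relator h g) ∧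
    f = toRealComb g - toRealComb h}

/-- The positive cone of formal combinations. -/
noncomputable def formalCone : PointedCone ℝ (E →₀ ℝ) := Submodule.span _ κ.coneGenerators

/-- The ordered vector space enveloping a convex effect algebra. -/
abbrev Envelope := ConeQuotient κ.formalCone

/-- The canonical map of a convex effect algebra into its envelope. -/
noncomputable def toEnvelope (x : E) : κ.Envelope := ConeQuotient.mk _ (Finsupp.single x 1)

theorem mk_single (x : E) (r : ℝ) :
    ConeQuotient.mk κ.formalCone (Finsupp.single x r) = r • κ.toEnvelope x := by
  rw [toEnvelope, ← map_smul, Finsupp.smul_single, smul_eq_mul, mul_one]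

theorem mk_relator {g h : E →₀ NNReal} (H : κ.Relator g h) :
    ConeQuotient.mk κ.formalCone (toRealComb g) = ConeQuotient.mk κ.formalCone (toRealComb h) := by
  rw [← sub_eq_zero, ← map_sub, ConeQuotient.mk_eq_zero, neg_sub]
  exact ⟨Submodule.subset_span (Or.inr ⟨g, h, Or.inl H, rfl⟩),
    Submodule.subset_span (Or.inr ⟨h, g, Or.inr H, rfl⟩)⟩

theorem toEnvelope_add {x y z : E} (h : of x + of y = of z) :
    κ.toEnvelope x + κ.toEnvelope y = κ.toEnvelope z := by
  have := κ.mk_relator (.ovee x y z h)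
  simpa [map_add, toRealComb_single, mk_single] using this

theorem toEnvelope_act (r : unitInterval) (x : E) :
    κ.toEnvelope (κ.act r x) = (r : ℝ) • κ.toEnvelope x := by
  have := κ.mk_relator (.act r x)
  simpa [toRealComb_single, mk_single, r.2.1] using this.symm

theorem toEnvelope_nonneg (x : E) : 0 ≤ κ.toEnvelope x := by
  rw [← map_zero (ConeQuotient.mk κ.formalCone), toEnvelope, ConeQuotient.mk_le_mk, sub_zero]
  exact Submodule.subset_span (Or.inl ⟨x, rfl⟩)

theorem toEnvelope_mono {x y : E} (h : x ≤ y) : κ.toEnvelope x ≤ κ.toEnvelope y := by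
  obtain ⟨z, hz⟩ := h
  rw [← κ.toEnvelope_add hz]
  exact le_add_of_nonneg_right (κ.toEnvelope_nonneg z)

/-- Values of formal combinations, after scaling by `1 / (n + 1)` for large `n`. -/
noncomputable def evalGerm (h : IsEffectAlgebra top) :
    (E →₀ NNReal) →+ Germ (atTop : Filter ℕ) (PartialSum E) :=
  Finsupp.liftAddHom fun x =>
    { toFun := fun c => ((fun n : ℕ => κ.sm (c / (n + 1)) x : ℕ → PartialSum E) : Germ _ _)
      map_zero' := by
        refine Germ.coe_eq.2 (.of_forall fun n => ?_)
        simpa using κ.sm_zero h x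
      map_add' := fun c d => by
        refine Germ.coe_eq.2 ?_
        filter_upwards [eventually_ge_atTop ⌈(c + d : ℝ)⌉₊] with n hn
        have hn' : (c + d : ℝ) ≤ n := Nat.ceil_le.1 hn
        have : (c : ℝ) / (n + 1) + d / (n + 1) ≤ 1 := by
          rw [← add_div, div_le_one (by positivity)]
          linarith
        change _ = κ.sm (c / (n + 1)) x + κ.sm (d / (n + 1)) x
        rw [← κ.sm_add (by positivity) (by positivity) this, NNReal.coe_add, add_div] }

theorem evalGerm_single (h : IsEffectAlgebra top) (x : E) (c : NNReal) :
    κ.evalGerm h (Finsupp.single x c) =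
      ((fun n : ℕ => κ.sm (c / (n + 1)) x : ℕ → PartialSum E) : Germ _ _) := by
  simp only [evalGerm, Finsupp.liftAddHom_apply_single]
  rfl

theorem eventually_div_le_one (c : NNReal) : ∀ᶠ n : ℕ in atTop, (c : ℝ) / (n + 1) ≤ 1 := by
  filter_upwards [eventually_ge_atTop ⌈(c : ℝ)⌉₊] with n hn
  have hn' : (c : ℝ) ≤ n := Nat.ceil_le.1 hn
  rw [div_le_one (by positivity)]
  linarith

theorem evalGerm_relator (h : IsEffectAlgebra top) {g k : E →₀ NNReal} (H : κ.Relator g k)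
    (c : NNReal) : κ.evalGerm h (c • g) = κ.evalGerm h (c • k) := by
  cases H with
  | ovee x y z hz =>
    simp only [smul_add, Finsupp.smul_single, map_add, evalGerm_single]
    refine Germ.coe_eq.2 ?_
    filter_upwards [eventually_div_le_one (c • 1)] with n hn
    exact κ.sm_of_add (by positivity) hn hz
  | act r x =>
    rw [Finsupp.smul_single, Finsupp.smul_single, evalGerm_single, evalGerm_single]
    refine Germ.coe_eq.2 ?_
    filter_upwards [eventually_div_le_one (c • 1)] with n hn
    rw [κ.sm_act (by positivity) hn]
    congr 1
    simp only [smul_eq_mul, NNReal.coe_mul, Real.coe_toNNReal _ r.2.1, NNReal.coe_one]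
    ring

/-- Undefined sums would also count as equal germs. Completing a combination to a multiple of `top`,
whose value is defined for large `n`, certifies that its own value is defined, which is what
cancellation needs. -/
theorem exists_evalGerm_add (h : IsEffectAlgebra top) (g : E →₀ NNReal) :
    ∃ (g' : E →₀ NNReal) (c : NNReal),
      κ.evalGerm h (g + g') = κ.evalGerm h (Finsupp.single top c) := by
  induction g using Finsupp.induction_linear with
  | zero => exact ⟨0, 0, by simp⟩
  | add g k hg hk =>
    obtain ⟨g', c, hg⟩ := hg
    obtain ⟨k', d, hk⟩ := hk
    refine ⟨g' + k', c + d, ?_⟩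
    rw [add_add_add_comm, map_add, hg, hk, Finsupp.single_add, map_add]
  | single x c =>
    refine ⟨Finsupp.single (h.ortho x) c, c, ?_⟩
    have := κ.evalGerm_relator h (.ovee x _ _ (h.add_ortho x)) c
    simpa [smul_add] using this

/-- Membership in the cone is expressed without subtraction: `f` is a difference `g - k` in which
`g` evaluates to `k` plus something. The relators, in either direction, need no extra term. -/
theorem formalCone_induction (h : IsEffectAlgebra top) {f : E →₀ ℝ} (hf : f ∈ κ.formalCone) :
    ∃ g k l : E →₀ NNReal, f + toRealComb k = toRealComb g ∧
      κ.evalGerm h (k + l) = κ.evalGerm h g := by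
  induction hf using Submodule.closure_induction with
  | zero => exact ⟨0, 0, 0, by simp, by simp⟩
  | add f f' _ _ hf hf' =>
    obtain ⟨g, k, l, h1, h2⟩ := hf
    obtain ⟨g', k', l', h1', h2'⟩ := hf'
    refine ⟨g + g', k + k', l + l', ?_, ?_⟩
    · rw [map_add, map_add, ← h1, ← h1']
      abel
    · rw [add_add_add_comm, map_add, h2, h2', map_add]
  | smul_mem r f hf =>
    obtain ⟨r, hr⟩ := r
    lift r to NNReal using hr
    have hs : ∀ g : E →₀ ℝ, (⟨(r : ℝ), r.2⟩ : {c : ℝ // 0 ≤ c}) • g = r • g := fun _ => rfl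
    rcases hf with ⟨x, rfl⟩ | ⟨g, k, H, rfl⟩
    · refine ⟨Finsupp.single x r, 0, Finsupp.single x r, ?_, by simp⟩
      rw [map_zero, add_zero, toRealComb_single]
      ext y
      by_cases hxy : x = y <;> simp [hxy, hs, NNReal.smul_def]
    · refine ⟨r • g, r • k, 0, ?_, ?_⟩
      · rw [map_smul, map_smul, hs, smul_sub, sub_add_cancel]
      · rw [add_zero]
        exact H.elim (fun H => (κ.evalGerm_relator h H r).symm) (fun H => κ.evalGerm_relator h H r)

/-- The envelope creates no new inequalities. An inequality there is a formal identity between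
nonnegative combinations; scaled down by a large `n + 1` it can be evaluated inside `E`, cancelled
there, and scaled back up by summing `n + 1` copies. -/
theorem le_of_toEnvelope_le (h : IsEffectAlgebra top) {a b : E}
    (hab : κ.toEnvelope a ≤ κ.toEnvelope b) : a ≤ b := by
  rw [toEnvelope, toEnvelope, ConeQuotient.mk_le_mk] at hab
  obtain ⟨g, k, l, h1, h2⟩ := κ.formalCone_induction h hab
  have h3 : Finsupp.single b 1 + k = Finsupp.single a 1 + g := by
    apply toRealComb_injective
    rw [map_add, map_add, ← h1, toRealComb_single, toRealComb_single, NNReal.coe_one]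
    abel
  obtain ⟨g', c, h4⟩ := κ.exists_evalGerm_add h (Finsupp.single b 1 + k)
  replace h3 := congrArg (κ.evalGerm h) h3
  simp only [map_add, evalGerm_single] at h2 h3 h4
  rw [← h2] at h3
  generalize κ.evalGerm h k = K at h2 h3 h4
  generalize κ.evalGerm h g' = G' at h2 h3 h4
  generalize κ.evalGerm h l = L at h2 h3 h4
  induction K using Germ.inductionOn with | _ K
  induction L using Germ.inductionOn with | _ L
  induction G' using Germ.inductionOn with | _ G'
  replace h3 := Germ.coe_eq.1 h3
  replace h4 := Germ.coe_eq.1 h4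
  -- One index at which both germ identities hold and the multiple of `top` is defined.
  obtain ⟨n, h3, h4, hn⟩ := (h3.and (h4.and (eventually_div_le_one c))).exists
  change κ.sm ((1 : NNReal) / (n + 1)) b + K n =
    κ.sm ((1 : NNReal) / (n + 1)) a + (K n + L n) at h3
  change κ.sm ((1 : NNReal) / (n + 1)) b + K n + G' n = κ.sm (c / (n + 1)) top at h4
  rw [κ.sm_eq (by positivity) hn] at h4
  set r : ℝ := (1 : NNReal) / (n + 1) with hr
  have hr0 : 0 ≤ r := by positivity
  have hr1 : (n + 1 : ℕ) * r = 1 := by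
    rw [hr]
    push_cast
    field_simp
  have h5 : (κ.sm r a + L n) + (K n + G' n) = _ := Eq.trans (by rw [h3]; abel) h4
  have h6 : κ.sm r b + (K n + G' n) = _ := (add_assoc _ _ _).symm.trans h4
  obtain ⟨t, ht⟩ := exists_of_add ((add_comm _ _).trans h6)
  rw [ht, add_comm] at h5 h6
  -- Cancelling the defined element `t = K n + G' n` leaves `r a + L n = r b` with `(n + 1) r = 1`.
  have h7 := congrArg (fun z => (n + 1) • z) (h.cancel h5 h6)
  simp only [nsmul_add] at h7
  rw [κ.nsmul_sm hr0 hr1.le _ (κ.sm_zero h a), κ.nsmul_sm hr0 hr1.le _ (κ.sm_zero h b), hr1,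
    sm_one, sm_one] at h7
  exact le_of_add h7

theorem toEnvelope_injective (h : IsEffectAlgebra top) : Function.Injective κ.toEnvelope :=
  fun _ _ hab => h.le_antisymm (κ.le_of_toEnvelope_le h hab.le) (κ.le_of_toEnvelope_le h hab.ge)

theorem toEnvelope_combo (h : IsEffectAlgebra top) (x y : E) {r s : ℝ} (hr : 0 ≤ r) (hs : 0 ≤ s)
    (hrs : r + s ≤ 1) : ∃ z, κ.toEnvelope z = r • κ.toEnvelope x + s • κ.toEnvelope y := by
  obtain ⟨z, hz⟩ := κ.exists_sm_add h hr hs hrs x y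
  rw [κ.sm_eq hr (by linarith), κ.sm_eq hs (by linarith)] at hz
  exact ⟨z, by rw [← κ.toEnvelope_add hz, toEnvelope_act, toEnvelope_act]⟩

theorem exists_toEnvelope_sub (h : IsEffectAlgebra top) (v : κ.Envelope) :
    ∃ (N : ℝ) (a b : E), 0 < N ∧ v = N • (κ.toEnvelope a - κ.toEnvelope b) := by
  have key : ∀ f : E →₀ ℝ, ∃ (N : ℝ) (a b : E), 0 < N ∧
      ConeQuotient.mk κ.formalCone f = N • (κ.toEnvelope a - κ.toEnvelope b) := by
    intro f
    induction f using Finsupp.induction_linear with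
    | zero => exact ⟨1, 0, 0, one_pos, by simp⟩
    | add f g hf hg =>
      obtain ⟨N, a, b, hN, hf⟩ := hf
      obtain ⟨M, c, d, hM, hg⟩ := hg
      -- Weights proportional to `N` and `M` turn the sum into `N + M` times a difference of convex
      -- combinations, which remain in `E`.
      have h1 : N / (N + M) + M / (N + M) ≤ 1 := by
        rw [← add_div, div_self (by positivity)]
      obtain ⟨x, hx⟩ := κ.toEnvelope_combo h a c (by positivity) (by positivity) h1
      obtain ⟨y, hy⟩ := κ.toEnvelope_combo h b d (by positivity) (by positivity) h1
      refine ⟨N + M, x, y, by positivity, ?_⟩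
      have h2 : N = (N + M) * (N / (N + M)) := by field_simp
      have h3 : M = (N + M) * (M / (N + M)) := by field_simp
      rw [map_add, hf, hg, hx, hy, smul_sub, smul_sub, smul_sub, smul_add, smul_add, smul_smul,
        smul_smul, smul_smul, smul_smul, ← h2, ← h3]
      abel
    | single x r =>
      rw [mk_single]
      have h0 : κ.toEnvelope 0 = 0 := by
        have := κ.toEnvelope_add (x := 0) (y := 0) (z := 0) (by rw [of_zero, add_zero])
        simpa using this
      rcases lt_trichotomy r 0 with hr | rfl | hr
      · exact ⟨-r, 0, x, by linarith, by simp [h0]⟩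
      · exact ⟨1, 0, 0, one_pos, by simp⟩
      · exact ⟨r, x, 0, hr, by simp [h0]⟩
  obtain ⟨f, rfl⟩ := ConeQuotient.mk_surjective _ v
  exact key f

theorem exists_toEnvelope_of_nonneg (h : IsEffectAlgebra top) {v : κ.Envelope} (hv : 0 ≤ v) :
    ∃ (N : ℝ) (a : E), 0 < N ∧ v = N • κ.toEnvelope a := by
  obtain ⟨N, a, b, hN, rfl⟩ := κ.exists_toEnvelope_sub h v
  have h1 : κ.toEnvelope b ≤ κ.toEnvelope a := by
    have := smul_le_smul_of_nonneg_left hv (inv_nonneg.2 hN.le)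
    rwa [smul_zero, smul_smul, inv_mul_cancel₀ hN.ne', one_smul, sub_nonneg] at this
  obtain ⟨z, hz⟩ := κ.le_of_toEnvelope_le h h1
  exact ⟨N, z, hN, by rw [← κ.toEnvelope_add hz, add_sub_cancel_left]⟩

/-- In `v = N a` the factor may exceed `1`. With `k ≥ N`, the element `b = (N / k) a` lies below `(1
/ k) top`, so `k` copies of `b` are summable because `k` copies of `(1 / k) top` are; their sum is
`v`. -/
theorem exists_toEnvelope_eq (h : IsEffectAlgebra top) {v : κ.Envelope} (hv : 0 ≤ v)
    (hv1 : v ≤ κ.toEnvelope top) : ∃ a, κ.toEnvelope a = v := by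
  obtain ⟨N, a, hN, rfl⟩ := κ.exists_toEnvelope_of_nonneg h hv
  obtain ⟨k, hk⟩ := exists_nat_ge N
  have hk0 : (0 : ℝ) < k := hN.trans_le hk
  have hk' : (k : ℝ) ≠ 0 := hk0.ne'
  have hk1 : (1 : ℝ) / k ≤ 1 := by
    rw [div_le_one hk0]
    exact_mod_cast Nat.one_le_iff_ne_zero.2 (by exact_mod_cast hk')
  obtain ⟨b, hb⟩ : ∃ b, κ.toEnvelope b = (N / k) • κ.toEnvelope a :=
    ⟨κ.act ⟨N / k, by positivity, (div_le_one hk0).2 hk⟩ a, toEnvelope_act _ _ _⟩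
  obtain ⟨c, hc, hc'⟩ : ∃ c, κ.sm (1 / k) top = of c ∧
      κ.toEnvelope c = (1 / k : ℝ) • κ.toEnvelope top :=
    ⟨_, κ.sm_eq (by positivity) hk1 top, toEnvelope_act _ _ _⟩
  have hbc : b ≤ c := κ.le_of_toEnvelope_le h (by
    rw [hb, hc', div_eq_inv_mul, mul_smul, one_div]
    exact smul_le_smul_of_nonneg_left hv1 (by positivity))
  obtain ⟨d, hd⟩ := hbc
  have hd : of b + of d = of c := hd
  have h1 : k • of b + k • of d = of top := by
    rw [← nsmul_add, hd, ← hc, κ.nsmul_sm (by positivity) _ _ (κ.sm_zero h top),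
      mul_one_div_cancel hk', sm_one]
    rw [mul_one_div_cancel hk']
  obtain ⟨y, hy⟩ := exists_of_add h1
  refine ⟨y, ?_⟩
  have h2 : ∀ (m : ℕ) (z : E), m • of b = of z → κ.toEnvelope z = (m : ℝ) • κ.toEnvelope b := by
    intro m
    induction m with
    | zero =>
      intro z hz
      rw [zero_nsmul, ← of_zero] at hz
      rw [← of_injective hz]
      have := κ.toEnvelope_add (x := 0) (y := 0) (z := 0) (by rw [of_zero, add_zero])
      simpa using this
    | succ m ih =>
      intro z hz
      rw [succ_nsmul] at hz
      obtain ⟨w, hw⟩ := exists_of_add hz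
      rw [hw] at hz
      rw [← κ.toEnvelope_add hz, ih w hw]
      push_cast
      rw [add_smul, one_smul]
  rw [h2 k y hy, hb, smul_smul, mul_div_cancel₀ _ hk']

end ConvexAction

/-! ### The Archimedean property from directed completeness -/

namespace ConvexAction
open PartialSum Filter
variable {E : Type v} [PCM E] {top : E} (κ : ConvexAction E)

theorem directedOn_range (h : IsEffectAlgebra top) {f : ℕ → E}
    (hf : Monotone fun n => κ.toEnvelope (f n)) : DirectedOn (· ≤ ·) (Set.range f) := by
  rintro _ ⟨m, rfl⟩ _ ⟨n, rfl⟩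
  exact ⟨f (max m n), ⟨_, rfl⟩, κ.le_of_toEnvelope_le h (hf (le_max_left m n)),
    κ.le_of_toEnvelope_le h (hf (le_max_right m n))⟩

/-- If `s` is the supremum of the multiples `n v`, then `s - v` is again an upper bound, so `v ≤ 0`.
-/
theorem toEnvelope_eq_zero_of_infinitesimal (h : IsEffectAlgebra top)
    (hd : IsDirectedComplete E) {v : κ.Envelope} (h0 : 0 ≤ v)
    (hv : ∀ n : ℕ, (n : ℝ) • v ≤ κ.toEnvelope top) : v = 0 := by
  choose f hf using fun n : ℕ => κ.exists_toEnvelope_eq h (smul_nonneg n.cast_nonneg h0) (hv n)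
  have hmono : Monotone fun n => κ.toEnvelope (f n) := monotone_nat_of_le_succ fun n => by
    rw [hf, hf]
    exact smul_le_smul_of_nonneg_right (by push_cast; linarith) h0
  obtain ⟨s, hs⟩ := hd _ (κ.directedOn_range h hmono)
  have hub : ∀ n, κ.toEnvelope (f n) ≤ κ.toEnvelope s := fun n =>
    κ.toEnvelope_mono (hs.1 ⟨n, rfl⟩)
  obtain ⟨w, hw⟩ := κ.exists_toEnvelope_eq h (v := κ.toEnvelope s - v)
    (sub_nonneg.2 (by simpa [hf] using hub 1))
    ((sub_le_self _ h0).trans (κ.toEnvelope_mono (h.le_top s)))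
  have hsw : s ≤ w := hs.2 (by
    rintro _ ⟨n, rfl⟩
    refine κ.le_of_toEnvelope_le h ?_
    rw [hw, le_sub_iff_add_le]
    refine le_trans (le_of_eq ?_) (hub (n + 1))
    rw [hf, hf]
    push_cast
    rw [add_smul, one_smul])
  have := κ.toEnvelope_mono hsw
  rw [hw, le_sub_self_iff] at this
  exact le_antisymm this h0

theorem toEnvelope_top_nonneg : 0 ≤ κ.toEnvelope top := κ.toEnvelope_nonneg top

/-- The increasing sequence `1 - b - 1/(n + 2)` has supremum `1 - b`, since the defect is
infinitesimal, and is bounded by `1 - a`. The bound `b ≤ 1/2` keeps the sequence inside the unit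
interval. -/
theorem toEnvelope_le_add (h : IsEffectAlgebra top) (hd : IsDirectedComplete E) {a b : E}
    (hab : ∀ ε : ℝ, 0 < ε → κ.toEnvelope a ≤ κ.toEnvelope b + ε • κ.toEnvelope top)
    (hb : κ.toEnvelope b ≤ (1 / 2 : ℝ) • κ.toEnvelope top) :
    κ.toEnvelope a ≤ κ.toEnvelope b := by
  set e := κ.toEnvelope top with he
  have he0 : 0 ≤ e := κ.toEnvelope_top_nonneg
  have hδ : ∀ n : ℕ, (1 / (n + 2 : ℝ)) ≤ 1 / 2 := fun n => by
    apply one_div_le_one_div_of_le <;> [norm_num; linarith [n.cast_nonneg (α := ℝ)]]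
  have hbn : ∀ n : ℕ, κ.toEnvelope b + (1 / (n + 2 : ℝ)) • e ≤ e := fun n => by
    refine (add_le_add hb (smul_le_smul_of_nonneg_right (hδ n) he0)).trans (le_of_eq ?_)
    rw [← add_smul]
    norm_num
  choose f hf using fun n : ℕ => κ.exists_toEnvelope_eq h
    (v := e - (κ.toEnvelope b + (1 / (n + 2 : ℝ)) • e)) (sub_nonneg.2 (hbn n))
    (sub_le_self _ (add_nonneg (κ.toEnvelope_nonneg b) (smul_nonneg (by positivity) he0)))
  have hmono : Monotone fun n => κ.toEnvelope (f n) := monotone_nat_of_le_succ fun n => by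
    rw [hf, hf]
    refine sub_le_sub_left (add_le_add_right (smul_le_smul_of_nonneg_right ?_ he0) _) _
    apply one_div_le_one_div_of_le <;> [positivity; (push_cast; linarith)]
  obtain ⟨s, hs⟩ := hd _ (κ.directedOn_range h hmono)
  have horth : ∀ x : E, κ.toEnvelope (h.ortho x) = e - κ.toEnvelope x := fun x => by
    rw [eq_sub_iff_add_eq, add_comm]
    exact κ.toEnvelope_add (h.add_ortho x)
  have hsb : κ.toEnvelope s ≤ e - κ.toEnvelope b := by
    rw [← horth]
    refine κ.toEnvelope_mono (hs.2 ?_)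
    rintro _ ⟨n, rfl⟩
    refine κ.le_of_toEnvelope_le h ?_
    rw [hf, horth]
    exact sub_le_sub_left (le_add_of_nonneg_right (smul_nonneg (by positivity) he0)) _
  have hsb' : e - κ.toEnvelope b - κ.toEnvelope s = 0 := by
    refine κ.toEnvelope_eq_zero_of_infinitesimal h hd (sub_nonneg.2 hsb) fun n => ?_
    have h1 := κ.toEnvelope_mono (hs.1 ⟨n, rfl⟩)
    rw [hf] at h1
    have h2 : e - κ.toEnvelope b - κ.toEnvelope s ≤ (1 / (n + 2 : ℝ)) • e := by
      rw [sub_le_iff_le_add, ← sub_le_iff_le_add', sub_sub]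
      exact h1
    calc (n : ℝ) • (e - κ.toEnvelope b - κ.toEnvelope s)
        ≤ (n : ℝ) • (1 / (n + 2 : ℝ)) • e := smul_le_smul_of_nonneg_left h2 n.cast_nonneg
      _ = (n / (n + 2 : ℝ)) • e := by rw [smul_smul, mul_one_div]
      _ ≤ (1 : ℝ) • e := by
        refine smul_le_smul_of_nonneg_right ?_ he0
        rw [div_le_one (by positivity)]
        linarith
      _ = e := one_smul _ _
  have hsa : κ.toEnvelope s ≤ e - κ.toEnvelope a := by
    rw [← horth]
    refine κ.toEnvelope_mono (hs.2 ?_)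
    rintro _ ⟨n, rfl⟩
    refine κ.le_of_toEnvelope_le h ?_
    rw [hf, horth]
    exact sub_le_sub_left (hab _ (by positivity)) _
  rw [sub_eq_zero] at hsb'
  rw [← hsb'] at hsa
  exact (sub_le_sub_iff_left e).1 hsa

theorem envelope_archimedean (h : IsEffectAlgebra top) (hd : IsDirectedComplete E)
    (x : κ.Envelope) (hx : ∀ ε : ℝ, 0 < ε → x ≤ ε • κ.toEnvelope top) : x ≤ 0 := by
  obtain ⟨N, a, b, hN, rfl⟩ := κ.exists_toEnvelope_sub h x
  -- Halving both elements secures the bound by `1/2` that `toEnvelope_le_add` requires.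
  have hhalf : ∀ z : E, ∃ w, κ.toEnvelope w = (1 / 2 : ℝ) • κ.toEnvelope z := fun z =>
    ⟨κ.act ⟨1 / 2, by norm_num, by norm_num⟩ z, toEnvelope_act _ _ _⟩
  obtain ⟨a', ha⟩ := hhalf a
  obtain ⟨b', hb⟩ := hhalf b
  have h1 : κ.toEnvelope a' ≤ κ.toEnvelope b' := by
    refine κ.toEnvelope_le_add h hd (fun ε hε => ?_) ?_
    · have := smul_le_smul_of_nonneg_left (hx (2 * N * ε) (by positivity))
        (show (0 : ℝ) ≤ (2 * N)⁻¹ by positivity)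
      rw [smul_smul, smul_smul, inv_mul_cancel_left₀ (by positivity)] at this
      have h2 : (2 * N)⁻¹ * N = 1 / 2 := by field_simp
      rw [h2, smul_sub, ← ha, ← hb, sub_le_iff_le_add'] at this
      exact this
    · rw [hb]
      exact smul_le_smul_of_nonneg_left (κ.toEnvelope_mono (h.le_top b)) (by norm_num)
  rw [ha, hb] at h1
  have h3 := smul_le_smul_of_nonneg_left h1 (show (0 : ℝ) ≤ 2 * N by positivity)
  rw [smul_smul, smul_smul, show 2 * N * (1 / 2) = N by ring] at h3
  rw [smul_sub, sub_nonpos]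
  exact h3

theorem exists_unit_bound (h : IsEffectAlgebra top) (x : κ.Envelope) :
    ∃ r : ℝ, 0 ≤ r ∧ -(r • κ.toEnvelope top) ≤ x ∧ x ≤ r • κ.toEnvelope top := by
  obtain ⟨N, a, b, hN, rfl⟩ := κ.exists_toEnvelope_sub h x
  refine ⟨N, hN.le, ?_, smul_le_smul_of_nonneg_left ?_ hN.le⟩
  · rw [← smul_neg]
    refine smul_le_smul_of_nonneg_left ?_ hN.le
    rw [neg_le, neg_sub]
    exact (sub_le_self _ (κ.toEnvelope_nonneg a)).trans (κ.toEnvelope_mono (h.le_top b))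
  · exact (sub_le_self _ (κ.toEnvelope_nonneg b)).trans (κ.toEnvelope_mono (h.le_top a))

/-- The envelope of a directed complete convex effect algebra is an order unit space. -/
noncomputable abbrev envelopeOrderUnitSpace (h : IsEffectAlgebra top)
    (hd : IsDirectedComplete E) : OrderUnitSpace κ.Envelope :=
  OrderUnitSpace.ofArchimedean κ.toEnvelope_top_nonneg (κ.exists_unit_bound h)
    (κ.envelope_archimedean h hd)

/-- A directed complete convex effect algebra is the unit interval of an order unit space. -/
theorem exists_orderUnitSpace (h : IsEffectAlgebra top) (hd : IsDirectedComplete E) :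
    ∃ (V : Type v) (_ : OrderUnitSpace V) (φ : E → V),
      Set.BijOn φ Set.univ (Set.Icc 0 OrderUnitSpace.ounit) ∧ φ top = OrderUnitSpace.ounit ∧
      (∀ x y z, PCM.ovee x y = some z ↔ φ x + φ y = φ z) ∧
      ∀ (r : unitInterval) x, φ (κ.act r x) = (r : ℝ) • φ x := by
  refine ⟨κ.Envelope, κ.envelopeOrderUnitSpace h hd, κ.toEnvelope, ⟨?_, ?_, ?_⟩, rfl, ?_, ?_⟩
  · exact fun x _ => ⟨κ.toEnvelope_nonneg x, κ.toEnvelope_mono (h.le_top x)⟩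
  · exact (κ.toEnvelope_injective h).injOn
  · rintro v ⟨h0, h1⟩
    obtain ⟨a, rfl⟩ := κ.exists_toEnvelope_eq h h0 h1
    exact ⟨a, trivial, rfl⟩
  · intro x y z
    constructor
    · exact fun hz => κ.toEnvelope_add hz
    · intro hz
      have hxz : κ.toEnvelope x ≤ κ.toEnvelope z := by
        rw [← (show _ = κ.toEnvelope z from hz)]
        exact le_add_of_nonneg_right (κ.toEnvelope_nonneg y)
      obtain ⟨y', hy'⟩ := κ.le_of_toEnvelope_le h hxz
      have h1 := κ.toEnvelope_add hy'
      rw [← (show _ = κ.toEnvelope z from hz)] at h1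
      rw [← κ.toEnvelope_injective h (add_left_cancel h1)]
      exact hy'
  · exact fun r x => κ.toEnvelope_act r x

end ConvexAction

/-! ### Norm and order in order unit spaces -/

namespace OrderUnitSpace
variable {V : Type*} [OrderUnitSpace V]

theorem bddBelow_norm_set (x : V) :
    BddBelow {r : ℝ | 0 ≤ r ∧ -(r • (ounit : V)) ≤ x ∧ x ≤ r • ounit} := ⟨0, fun _ h => h.1⟩

theorem norm_le {x : V} {r : ℝ} (h0 : 0 ≤ r) (h1 : -(r • ounit) ≤ x) (h2 : x ≤ r • ounit) :
    ‖x‖ ≤ r := by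
  rw [norm_eq]
  exact csInf_le (bddBelow_norm_set x) ⟨h0, h1, h2⟩

theorem le_of_forall_pos {x y : V} (h : ∀ ε : ℝ, 0 < ε → x ≤ y + ε • ounit) : x ≤ y := by
  have h1 : Filter.Tendsto (fun ε : ℝ => y - x + ε • (ounit : V)) (nhdsWithin 0 (Set.Ioi 0))
      (nhds (y - x + (0 : ℝ) • ounit)) :=
    ((continuous_const.add (continuous_id.smul continuous_const)).tendsto 0).mono_left
      nhdsWithin_le_nhds
  have h2 := isClosed_nonneg.mem_of_tendsto h1 (by
    filter_upwards [self_mem_nhdsWithin] with ε hε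
    have := h ε hε
    change 0 ≤ y - x + ε • (ounit : V)
    rw [sub_add_eq_add_sub, sub_nonneg]
    exact this)
  rw [zero_smul, add_zero] at h2
  exact sub_nonneg.1 h2

theorem le_norm_smul (x : V) : x ≤ ‖x‖ • ounit := by
  refine le_of_forall_pos fun ε hε => ?_
  obtain ⟨r, hr, hlt⟩ := exists_lt_of_csInf_lt (exists_bound x)
    (lt_add_of_pos_right _ hε)
  rw [← add_smul]
  refine hr.2.2.trans (smul_le_smul_of_nonneg_right ?_ ounit_nonneg)
  rw [norm_eq]
  exact hlt.le

theorem neg_norm_smul_le (x : V) : -(‖x‖ • ounit) ≤ x := by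
  have := le_norm_smul (-x)
  rw [norm_neg] at this
  exact neg_le.1 this

/-- An additive positive function on `[0, 1]` is linear. -/
theorem additive_eq_smul {f : ℝ → V} (hf : ∀ r, 0 ≤ r → r ≤ 1 → 0 ≤ f r)
    (hadd : ∀ r s, 0 ≤ r → 0 ≤ s → r + s ≤ 1 → f (r + s) = f r + f s) {r : ℝ} (h0 : 0 ≤ r)
    (h1 : r ≤ 1) : f r = r • f 1 := by
  have hmono : ∀ r s, 0 ≤ r → r ≤ s → s ≤ 1 → f r ≤ f s := fun r s hr hrs hs => by
    have := hadd r (s - r) hr (by linarith) (by linarith)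
    rw [add_sub_cancel] at this
    rw [this]
    exact le_add_of_nonneg_right (hf _ (by linarith) (by linarith))
  have hf0 : f 0 = 0 := by
    have := hadd 0 0 le_rfl le_rfl (by norm_num)
    simpa using this
  have hn : ∀ n : ℕ, 0 < n → ∀ k : ℕ, k ≤ n → f (k / n) = (k : ℝ) • f (1 / n) := by
    intro n hn k hk
    have hn' : (0 : ℝ) < n := by exact_mod_cast hn
    induction k with
    | zero => simp [hf0]
    | succ k ih =>
      have h2 : ((k : ℝ) + 1) / n ≤ 1 := by
        rw [div_le_one hn']
        exact_mod_cast hk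
      push_cast
      rw [add_div, hadd _ _ (by positivity) (by positivity) (by rwa [← add_div]), ih (by omega),
        add_smul, one_smul]
  have hrat : ∀ n : ℕ, 0 < n → ∀ k : ℕ, k ≤ n → f (k / n) = (k / n : ℝ) • f 1 := by
    intro n hn' k hk
    have hn0 : (n : ℝ) ≠ 0 := by exact_mod_cast hn'.ne'
    have h2 := hn n hn' n le_rfl
    rw [div_self hn0] at h2
    rw [hn n hn' k hk, h2, smul_smul, div_mul_cancel₀ _ hn0]
  -- Monotonicity squeezes `f r` between the values at `⌊r n⌋ / n` and `(⌊r n⌋ + 1) / n`, where `f`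
  -- is already linear.
  have hb : ∀ n : ℕ, 0 < n → ‖f r - r • f 1‖ ≤ (1 / n) * ‖f 1‖ := by
    intro n hn'
    have hn0 : (0 : ℝ) < n := by exact_mod_cast hn'
    have hf1 : 0 ≤ f 1 := hf 1 zero_le_one le_rfl
    rcases h1.eq_or_lt with rfl | h1
    · rw [one_smul, sub_self, norm_zero]
      positivity
    set k := ⌊r * n⌋₊ with hk
    have hk1 : (k : ℝ) ≤ r * n := Nat.floor_le (by positivity)
    have hk2 : r * n < k + 1 := Nat.lt_floor_add_one _
    have hkn : k + 1 ≤ n := by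
      have : (k : ℝ) < n := by nlinarith
      exact_mod_cast this
    have hl : (k / n : ℝ) ≤ r := by rwa [div_le_iff₀ hn0]
    have hu : r ≤ ((k + 1 : ℕ) / n : ℝ) := by
      rw [le_div_iff₀ hn0]
      push_cast
      exact hk2.le
    have h3 := hmono _ _ (by positivity) hl h1.le
    have h4 := hmono _ _ h0 hu (by rw [div_le_one hn0]; exact_mod_cast hkn)
    rw [hrat n hn' k (by omega)] at h3
    rw [hrat n hn' (k + 1) hkn] at h4
    have hle : (1 / n : ℝ) • f 1 ≤ ((1 / n) * ‖f 1‖) • ounit := by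
      rw [mul_smul]
      exact smul_le_smul_of_nonneg_left (le_norm_smul _) (by positivity)
    refine norm_le (by positivity) ?_ ?_
    · refine le_trans (neg_le_neg hle) ?_
      rw [neg_le_sub_iff_le_add]
      refine (smul_le_smul_of_nonneg_right hu hf1).trans ?_
      push_cast
      rw [add_div, add_smul]
      exact add_le_add_left h3 _
    · refine le_trans ?_ hle
      rw [sub_le_iff_le_add]
      refine h4.trans ?_
      push_cast
      rw [add_div, add_smul, add_comm]
      exact add_le_add_right (smul_le_smul_of_nonneg_right hl hf1) _
  have hlim : Filter.Tendsto (fun n : ℕ => (1 / (n : ℝ)) * ‖f 1‖) Filter.atTop (nhds (0 * ‖f 1‖)) :=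
    tendsto_one_div_atTop_nhds_zero_nat.mul_const _
  rw [zero_mul] at hlim
  have := ge_of_tendsto hlim (by
    filter_upwards [Filter.eventually_gt_atTop 0] with n hn' using hb n hn')
  rwa [norm_le_zero_iff, sub_eq_zero] at this

end OrderUnitSpace

/-! ### The convex structure on predicates -/

section Predicates
open PartialSum
variable {C : Type u} [Category.{v} C] [HasFiniteCoproducts C] [Effectus C]

/-- Composing `id + id⊥ = t` with the truth `t` gives `t + t ∘ id⊥ = t ∘ t ≤ t`. Hence `t ∘ id⊥ =
0`, and so `id⊥ = 0`. -/
theorem truth_unit : truth (Effectus.unit : C) = 𝟙 _ := by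
  set t := truth (Effectus.unit : C) with ht
  have h := Effectus.isEffectAlgebra (Effectus.unit : C)
  have h1 := h.add_ortho (𝟙 _)
  have h2 := FinPAC.ovee_comp _ _ _ t h1
  rw [Category.id_comp] at h2
  have h3 : (h.ortho (𝟙 _)) ≫ t = 0 := by
    have h4 : of t + of (h.ortho (𝟙 _) ≫ t) = of (t ≫ t) := h2
    have h5 := h.eq_top_of_top_le (le_of_add h4)
    have h6 : t ≫ t = t := h5
    rw [h6] at h4
    exact of_injective (h.cancel h4 (add_zero _))
  have h4 := Effectus.eq_zero_of_truth _ h3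
  rw [h4, of_zero, add_zero] at h1
  exact (of_injective h1).symm

variable (conv : ConvexAction (Pred (Effectus.unit (C := C))))

/-- Composition of scalars is multiplication of real numbers. -/
theorem scalar_comp (hd : IsDirectedComplete (Pred (Effectus.unit (C := C))))
    (r s : unitInterval) :
    (conv.act s (truth _) ≫ conv.act r (truth _) : Pred (Effectus.unit (C := C))) =
      conv.act (r * s) (truth _) := by
  obtain ⟨V, _, φ, hφ, htop, hadd, hact⟩ :=
    conv.exists_orderUnitSpace (Effectus.isEffectAlgebra _) hd
  classical
  -- As a function of the second scalar the composite is positive and additive, hence linear; its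
  -- value at `1` is the scalar `s`.
  set f : ℝ → V := fun t => if h : 0 ≤ t ∧ t ≤ 1 then
    φ (conv.act s (truth _) ≫ conv.act ⟨t, h⟩ (truth _)) else 0 with hf
  have hfr : ∀ t : unitInterval, f t = φ (conv.act s (truth _) ≫ conv.act t (truth _)) := by
    intro t
    have : (0 : ℝ) ≤ t ∧ (t : ℝ) ≤ 1 := ⟨t.2.1, t.2.2⟩
    simp [hf, this]
  have hpos : ∀ t, 0 ≤ t → t ≤ 1 → 0 ≤ f t := fun t h0 h1 => by
    rw [hfr ⟨t, h0, h1⟩]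
    exact (hφ.mapsTo trivial).1
  have hfadd : ∀ t t', 0 ≤ t → 0 ≤ t' → t + t' ≤ 1 → f (t + t') = f t + f t' := by
    intro t t' h0 h0' h1
    rw [hfr ⟨t, h0, by linarith⟩, hfr ⟨t', h0', by linarith⟩, hfr ⟨t + t', by linarith, h1⟩]
    refine ((hadd _ _ _).1 (FinPAC.comp_ovee _ _ _ _ ?_)).symm
    exact conv.add_act _ _ _ _ rfl
  have h := OrderUnitSpace.additive_eq_smul hpos hfadd r.2.1 r.2.2
  have h1 : f 1 = (s : ℝ) • φ (truth _) := by
    have h2 := hfr 1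
    rw [conv.one_act, truth_unit, Category.comp_id] at h2
    rw [truth_unit, ← hact]
    exact h2
  rw [h1, smul_smul] at h
  have h3 := hfr r
  rw [h] at h3
  refine hφ.injOn trivial trivial ?_
  rw [← h3, hact]
  rfl

/-- The convex structure on predicates induced by a convex structure on the scalars. -/
noncomputable def predAction (hd : IsDirectedComplete (Pred (Effectus.unit (C := C)))) (A : C) :
    ConvexAction (Pred A) where
  act r p := p ≫ conv.act r (truth _)
  act_act r s p := by rw [Category.assoc, scalar_comp conv hd]
  add_act r s t p h := FinPAC.comp_ovee _ _ _ _ (conv.add_act r s t _ h)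
  one_act p := by rw [conv.one_act, truth_unit, Category.comp_id]
  act_ovee r x y z h := FinPAC.ovee_comp _ _ _ _ h

theorem exists_isUnitIntervalIso (hn : IsNormalEffectus C) (A : C) :
    ∃ (V : Type v) (_ : OrderUnitSpace V) (φ : Pred A → V), IsUnitIntervalIso conv A φ := by
  obtain ⟨V, i, φ, h1, h2, h3, h4⟩ := (predAction conv (hn.directedComplete _) A).exists_orderUnitSpace
    (Effectus.isEffectAlgebra A) (hn.directedComplete A)
  exact ⟨V, i, φ, h1, h2, h3, h4⟩

end Predicates

/-! ### Comprehensions, filters, images and ceilings -/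

section EffectusBasics
open PartialSum
variable {C : Type u} [Category.{v} C] [HasFiniteCoproducts C] [Effectus C]

theorem comp_le_comp {A B : C} (f : A ⟶ B) {p q : Pred B} (h : p ≤ q) :
    (f ≫ p : Pred A) ≤ f ≫ q := by
  obtain ⟨r, hr⟩ := h
  exact ⟨f ≫ r, FinPAC.comp_ovee f _ _ _ hr⟩

theorem pred_le_antisymm {A : C} {p q : Pred A} (h1 : p ≤ q) (h2 : q ≤ p) : p = q :=
  (Effectus.isEffectAlgebra A).le_antisymm h1 h2

theorem le_truth {A : C} (p : Pred A) : p ≤ truth A := (Effectus.isEffectAlgebra A).le_top p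

theorem eq_truth {A : C} {p : Pred A} (h : truth A ≤ p) : p = truth A :=
  pred_le_antisymm (le_truth p) h

theorem ortho_ortho {A : C} (p : Pred A) : ortho (ortho p) = p :=
  (Effectus.isEffectAlgebra A).ortho_ortho p

theorem add_ortho {A : C} (p : Pred A) : PCM.ovee p (ortho p) = some (truth A) :=
  (Effectus.isEffectAlgebra A).add_ortho p

theorem comp_eq_truth_iff {A B : C} (f : A ⟶ B) (p : Pred B) :
    f ≫ p = f ≫ truth B ↔ f ≫ ortho p = 0 := by
  have h : of (f ≫ p) + of (f ≫ ortho p) = of (f ≫ truth B) :=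
    FinPAC.comp_ovee f _ _ _ (add_ortho p)
  constructor
  · intro h1
    rw [h1] at h
    exact of_injective ((Effectus.isEffectAlgebra A).cancel h (add_zero _))
  · intro h1
    rw [h1, of_zero, add_zero] at h
    exact of_injective h

theorem comp_eq_zero_iff {A B : C} (f : A ⟶ B) (p : Pred B) :
    f ≫ p = 0 ↔ f ≫ ortho p = f ≫ truth B := by
  rw [comp_eq_truth_iff, ortho_ortho]

theorem comp_eq_truth_mono {A B : C} {f : A ⟶ B} {p q : Pred B} (h : p ≤ q)
    (hp : f ≫ p = f ≫ truth B) : f ≫ q = f ≫ truth B :=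
  pred_le_antisymm (comp_le_comp f (le_truth q)) (hp ▸ comp_le_comp f h)

theorem IsTotal.of_comp {A B D : C} {f : A ⟶ B} {g : B ⟶ D} (h : IsTotal (f ≫ g)) :
    IsTotal f := by
  refine eq_truth ?_
  rw [← show _ = truth A from h, Category.assoc]
  exact comp_le_comp f (le_truth _)

theorem isTotal_id (A : C) : IsTotal (𝟙 A) := Category.id_comp _

theorem IsTotal.of_comp_eq_id {A B : C} {f : A ⟶ B} {g : B ⟶ A} (h : f ≫ g = 𝟙 A) : IsTotal f :=
  IsTotal.of_comp (g := g) (h ▸ isTotal_id A)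

theorem IsComprehension.cancel {A X B : C} {p : Pred A} {π : X ⟶ A} (h : IsComprehension p π)
    {g g' : B ⟶ X} (H : g ≫ π = g' ≫ π) : g = g' :=
  (h.final (g' ≫ π) (by rw [Category.assoc, h.truth_eq, Category.assoc])).unique H rfl

/-- The predicate `p`, as a map into the unit object, itself factors through the filter, because
`truth` of the unit object is the identity. -/
theorem IsFilter.truth_eq {A X : C} {p : Pred A} {ξ : A ⟶ X} (h : IsFilter p ξ) :
    ξ ≫ truth X = p := by
  obtain ⟨g, hg, -⟩ := h.initial (B := Effectus.unit) p
    (by rw [truth_unit, Category.comp_id]; exact pcm_le_refl p)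
  refine pred_le_antisymm h.truth_le ?_
  conv_lhs => rw [← show _ = p from hg]
  exact comp_le_comp ξ (le_truth g)

theorem IsFilter.cancel {A X B : C} {p : Pred A} {ξ : A ⟶ X} (h : IsFilter p ξ)
    {g g' : X ⟶ B} (H : ξ ≫ g = ξ ≫ g') : g = g' :=
  (h.initial (ξ ≫ g') (by
    rw [Category.assoc]
    exact pcm_le_trans (comp_le_comp ξ (le_truth _)) h.truth_le)).unique H rfl

theorem IsImage.unique {A B : C} {f : A ⟶ B} {p q : Pred B} (hp : IsImage f p)
    (hq : IsImage f q) : p = q :=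
  pred_le_antisymm (hp.least q hq.comp_eq) (hq.least p hp.comp_eq)

/-- Filters are epic, so precomposing with one does not change which predicates are true on `f`. -/
theorem IsFilter.isImage_comp_iff {A X B : C} {p : Pred A} {ξ : A ⟶ X} (h : IsFilter p ξ)
    {f : X ⟶ B} {r : Pred B} : IsImage (ξ ≫ f) r ↔ IsImage f r := by
  have key : ∀ q : Pred B, (ξ ≫ f) ≫ q = (ξ ≫ f) ≫ truth B ↔ f ≫ q = f ≫ truth B := fun q => by
    rw [Category.assoc, Category.assoc]
    exact ⟨h.cancel, fun H => by rw [H]⟩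
  exact ⟨fun H => ⟨(key r).1 H.comp_eq, fun q hq => H.least q ((key q).2 hq)⟩,
    fun H => ⟨(key r).2 H.comp_eq, fun q hq => H.least q ((key q).1 hq)⟩⟩

theorem IsImage.of_comprehension {A B X : C} {f : B ⟶ A} {p : Pred A} (hf : IsImage f p)
    {π : X ⟶ A} (h : IsComprehension p π) : IsImage π p := by
  refine ⟨h.truth_eq.symm, fun q hq => hf.least q ?_⟩
  obtain ⟨g, rfl, -⟩ := h.final f hf.comp_eq.symm
  rw [Category.assoc, hq, Category.assoc]

theorem IsComprehension.of_isImage {A X : C} {p r : Pred A} {π : X ⟶ A}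
    (h : IsComprehension p π) (hr : IsImage π r) : IsComprehension r π :=
  ⟨hr.comp_eq.symm, fun f hf =>
    h.final f (comp_eq_truth_mono (hr.least p h.truth_eq.symm) hf.symm).symm⟩

theorem isComprehension_of_iso {A X : C} (θ : X ⟶ A) (θ' : A ⟶ X) (h : θ ≫ θ' = 𝟙 X)
    (h' : θ' ≫ θ = 𝟙 A) : IsComprehension (truth A) θ :=
  ⟨rfl, fun f _ => ⟨f ≫ θ', by simp [h'], fun g hg => by simp [← hg, h]⟩⟩

theorem isFilter_id (A : C) : IsFilter (truth A) (𝟙 A) :=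
  ⟨le_truth _, fun f _ => ⟨f, Category.id_comp f, fun g hg => by simpa using hg⟩⟩

theorem isComprehension_id (A : C) : IsComprehension (truth A) (𝟙 A) :=
  isComprehension_of_iso _ _ (Category.id_comp _) (Category.id_comp _)

theorem isImage_id (A : C) : IsImage (𝟙 A) (truth A) :=
  ⟨rfl, fun q hq => by
    rw [Category.id_comp, Category.id_comp] at hq
    rw [hq]
    exact pcm_le_refl _⟩

theorem IsComprehension.isPure {A X : C} {p : Pred A} {π : X ⟶ A} (h : IsComprehension p π) :
    IsPure π := ⟨X, _, _, 𝟙 X, π, isFilter_id X, h, (Category.id_comp π).symm⟩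

theorem IsFilter.isPure {A X : C} {p : Pred A} {ξ : A ⟶ X} (h : IsFilter p ξ) :
    IsPure ξ := ⟨X, _, _, ξ, 𝟙 X, h, isComprehension_id X, (Category.comp_id ξ).symm⟩

theorem IsComprehension.exists_iso {A X Y : C} {p : Pred A} {π : X ⟶ A} {π' : Y ⟶ A}
    (h : IsComprehension p π) (h' : IsComprehension p π') :
    ∃ (θ : X ⟶ Y) (θ' : Y ⟶ X), θ ≫ π' = π ∧ θ ≫ θ' = 𝟙 X ∧ θ' ≫ θ = 𝟙 Y := by
  obtain ⟨θ, hθ, -⟩ := h'.final π h.truth_eq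
  obtain ⟨θ', hθ', -⟩ := h.final π' h'.truth_eq
  exact ⟨θ, θ', hθ, h.cancel (by simp [hθ, hθ']), h'.cancel (by simp [hθ, hθ'])⟩

theorem IsFilter.exists_iso {A X Y : C} {p : Pred A} {ξ : A ⟶ X} {ξ' : A ⟶ Y}
    (h : IsFilter p ξ) (h' : IsFilter p ξ') :
    ∃ (θ : X ⟶ Y) (θ' : Y ⟶ X), ξ ≫ θ = ξ' ∧ θ ≫ θ' = 𝟙 X ∧ θ' ≫ θ = 𝟙 Y := by
  obtain ⟨θ, hθ, -⟩ := h.initial ξ' h'.truth_le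
  obtain ⟨θ', hθ', -⟩ := h'.initial ξ h.truth_le
  exact ⟨θ, θ', hθ, h.cancel (by rw [← Category.assoc, hθ, hθ', Category.comp_id]),
    h'.cancel (by rw [← Category.assoc, hθ', hθ, Category.comp_id])⟩

theorem IsFloor.le {A : C} {p r : Pred A} (h : IsFloor p r) : r ≤ p := by
  obtain ⟨X, π, hπ, hr⟩ := h
  exact hr.least p hπ.truth_eq.symm

theorem IsFloor.isSharp {A : C} {p r : Pred A} (h : IsFloor p r) : IsSharp r := by
  obtain ⟨X, π, -, hr⟩ := h
  exact ⟨X, π, hr⟩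

/-- A map killing `u` factors through a comprehension of `ortho u`, whose image is `ortho c`. -/
theorem IsCeil.comp_eq_zero {A B : C} {u c : Pred A} (h : IsCeil u c) {f : B ⟶ A}
    (hf : f ≫ u = 0) : f ≫ c = 0 := by
  obtain ⟨X, π, hπ, hr⟩ := h
  obtain ⟨g, rfl, -⟩ := hπ.final f ((comp_eq_zero_iff f u).1 hf).symm
  rw [comp_eq_zero_iff, Category.assoc, hr.comp_eq, Category.assoc]

end EffectusBasics

/-! ### The dagger, isometries and assert maps -/

section Sequential
variable {C : Type u} [Category.{v} C] [HasFiniteCoproducts C] [Effectus C] [SequentialEffectus C]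

open SequentialEffectus

/-- Factor `π = ξ ≫ π'` through a filter of its own predicate. Then `π'` is total and factors back
through `π` by some `g` with `ξ ≫ g = 𝟙`, so `ξ` is total, and its predicate is that of `π`. -/
theorem IsComprehension.isTotal {A X : C} {p : Pred A} {π : X ⟶ A} (h : IsComprehension p π) :
    IsTotal π := by
  obtain ⟨Y, ξ, hξ⟩ := hasFilters (π ≫ truth A)
  obtain ⟨π', hπ', -⟩ := hξ.initial π (pcm_le_refl _)
  have h1 : π' ≫ truth A = truth Y := hξ.cancel (by
    rw [← Category.assoc, hπ', hξ.truth_eq])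
  have h2 : π' ≫ truth A = π' ≫ p := hξ.cancel (by
    rw [← Category.assoc, hπ', ← Category.assoc, hπ', h.truth_eq])
  obtain ⟨g, hg, -⟩ := h.final π' h2
  have h3 : IsTotal g := IsTotal.of_comp (g := π) (by rw [hg]; exact h1)
  have h4 : ξ ≫ g = 𝟙 X := h.cancel (by rw [Category.assoc, hg, hπ', Category.id_comp])
  have h5 : IsTotal ξ := IsTotal.of_comp_eq_id h4
  exact hξ.truth_eq.symm.trans h5

open Classical in
/-- The dagger of a pure map, extended by zero to all maps. -/
noncomputable def dg {A B : C} (f : A ⟶ B) : B ⟶ A :=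
  if h : IsPure f then (dagger (C := C)).dag f h else 0

theorem dg_eq {A B : C} {f : A ⟶ B} (hf : IsPure f) : dg f = (dagger (C := C)).dag f hf :=
  dif_pos hf

theorem isPure_dg {A B : C} {f : A ⟶ B} (hf : IsPure f) : IsPure (dg f) := by
  rw [dg_eq hf]
  exact (dagger (C := C)).pure_dag f hf

theorem dg_dg {A B : C} {f : A ⟶ B} (hf : IsPure f) : dg (dg f) = f := by
  rw [dg_eq (isPure_dg hf)]
  simp only [dg_eq hf]
  exact (dagger (C := C)).dag_dag f hf

theorem isPure_comp {A B D : C} {f : A ⟶ B} {g : B ⟶ D} (hf : IsPure f) (hg : IsPure g) :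
    IsPure (f ≫ g) := (dagger (C := C)).pure_comp hf hg

theorem dg_comp {A B D : C} {f : A ⟶ B} {g : B ⟶ D} (hf : IsPure f) (hg : IsPure g) :
    dg (f ≫ g) = dg g ≫ dg f := by
  rw [dg_eq hf, dg_eq hg, dg_eq (isPure_comp hf hg)]
  exact (dagger (C := C)).dag_comp f g hf hg

theorem isPure_id (A : C) : IsPure (𝟙 A) := (dagger (C := C)).pure_id A

theorem dg_id (A : C) : dg (𝟙 A) = 𝟙 A := by
  have h := dg_comp (isPure_dg (isPure_id A)) (isPure_id A)
  rw [Category.comp_id, dg_dg (isPure_id A), Category.comp_id] at h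
  exact h.symm

theorem isPositive_of_dg {A X : C} {g : X ⟶ A} (hg : IsPure g) :
    (dagger (C := C)).IsPositive (dg g ≫ g) := ⟨X, g, hg, by rw [dg_eq hg]⟩

theorem isPositive_of_comp_dg {A X : C} {g : A ⟶ X} (hg : IsPure g) :
    (dagger (C := C)).IsPositive (g ≫ dg g) := by
  have := isPositive_of_dg (isPure_dg hg)
  rwa [dg_dg hg] at this

theorem asrt_truth_eq_id (A : C) : asrt (truth A) = 𝟙 A := by
  refine (asrt_unique _ _ ?_ (Category.id_comp _)).symm
  have := isPositive_of_dg (isPure_id A)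
  rwa [Category.comp_id, dg_id] at this

/-- A total dagger-positive map is the assert map of the truth, by uniqueness. -/
theorem comp_dg_eq_id {A X : C} {g : A ⟶ X} (hg : IsPure g) (h1 : IsTotal (g ≫ dg g)) :
    g ≫ dg g = 𝟙 A := by
  rw [← asrt_truth_eq_id]
  exact asrt_unique _ _ (isPositive_of_comp_dg hg) h1

theorem isPure_asrt {A : C} (p : Pred A) : IsPure (asrt p) := by
  obtain ⟨X, g, hg, h⟩ := asrt_positive p
  rw [h, ← dg_eq hg]
  exact isPure_comp (isPure_dg hg) hg

theorem dg_asrt {A : C} (p : Pred A) : dg (asrt p) = asrt p := by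
  obtain ⟨X, g, hg, h⟩ := asrt_positive p
  rw [h, ← dg_eq hg, dg_comp (isPure_dg hg) hg, dg_dg hg]

/-- The image of an assert map is the ceiling of its predicate. -/
theorem isImage_asrt_iff {A : C} (p r : Pred A) : IsImage (asrt p) r ↔ IsCeil p r := by
  have h := diamond_adjoint (asrt p) (isPure_asrt p) (truth A) ⟨A, 𝟙 A, isImage_id A⟩ r
  -- Since `asrt p` is self-adjoint, ◇-adjointness at the truth says that the ceiling of `p` is the
  -- image of `asrt p` precomposed with a comprehension of the truth; such a comprehension has a
  -- section and does not affect the image.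
  rw [← dg_eq, dg_asrt, IsDiamondUpper, asrt_truth] at h
  rw [h]
  constructor
  · intro H
    exact ⟨A, 𝟙 A, isComprehension_id A, by rwa [Category.id_comp]⟩
  · rintro ⟨X, π, hπ, H⟩
    obtain ⟨g, hg, -⟩ := hπ.final (𝟙 A) rfl
    have key : ∀ q : Pred A, (π ≫ asrt p) ≫ q = (π ≫ asrt p) ≫ truth A ↔
        asrt p ≫ q = asrt p ≫ truth A := fun q => by
      constructor
      · intro hq
        have := congrArg (g ≫ ·) hq
        simpa [← Category.assoc, hg] using this
      · intro hq
        rw [Category.assoc, hq, Category.assoc]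
    exact ⟨(key r).1 H.comp_eq, fun q hq => H.least q ((key q).2 hq)⟩

theorem exists_isFloor {A : C} (p : Pred A) : ∃ r, IsFloor p r := by
  obtain ⟨X, π, hπ⟩ := hasComprehensions p
  obtain ⟨r, hr⟩ := comprehension_image p π hπ
  exact ⟨r, X, π, hπ, hr⟩

theorem exists_isCeil {A : C} (p : Pred A) : ∃ r, IsCeil p r := by
  obtain ⟨r, hr⟩ := exists_isFloor (ortho p)
  exact ⟨ortho r, by rwa [IsCeil, ortho_ortho]⟩

theorem IsSharp.isFloor {A : C} {p : Pred A} (h : IsSharp p) : IsFloor p p := by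
  obtain ⟨B, f, hf⟩ := h
  obtain ⟨X, π, hπ⟩ := hasComprehensions p
  exact ⟨X, π, hπ, hf.of_comprehension hπ⟩

theorem IsCeil.isSharp {A : C} {p r : Pred A} (h : IsCeil p r) : IsSharp r :=
  ⟨A, _, (isImage_asrt_iff p r).2 h⟩

omit [SequentialEffectus C] in
theorem IsFloor.isCeil_ortho {A : C} {p r : Pred A} (h : IsFloor p r) :
    IsCeil (ortho p) (ortho r) := by rwa [IsCeil, ortho_ortho, ortho_ortho]

theorem IsSharp.ortho {A : C} {p : Pred A} (h : IsSharp p) : IsSharp (ortho p) :=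
  h.isFloor.isCeil_ortho.isSharp

theorem IsSharp.isImage_asrt {A : C} {p : Pred A} (h : IsSharp p) : IsImage (asrt p) p :=
  (isImage_asrt_iff p p).2 h.ortho.isFloor

theorem IsSharp.asrt_comp_self {A : C} {p : Pred A} (h : IsSharp p) : asrt p ≫ p = p := by
  rw [h.isImage_asrt.comp_eq, asrt_truth]

theorem IsSharp.asrt_comp_asrt {A : C} {p : Pred A} (h : IsSharp p) :
    asrt p ≫ asrt p = asrt p := by
  refine asrt_unique _ _ ?_ ?_
  · have := isPositive_of_dg (isPure_asrt p)
    rwa [dg_asrt] at this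
  · rw [Category.assoc, asrt_truth, h.asrt_comp_self]

/-- Comprehensions are isometries. -/
theorem IsComprehension.comp_dg {A X : C} {p : Pred A} {π : X ⟶ A} (h : IsComprehension p π) :
    π ≫ dg π = 𝟙 X := by
  obtain ⟨r, hr⟩ := comprehension_image p π h
  have hsharp : IsSharp r := ⟨X, π, hr⟩
  obtain ⟨Y, u, t, ζ, ρ, hζ, hρ, hasrt⟩ := isPure_asrt r
  have hρr : IsComprehension r ρ :=
    hρ.of_isImage (hζ.isImage_comp_iff.1 (hasrt ▸ hsharp.isImage_asrt))
  have hζp := hζ.isPure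
  have hρp := hρ.isPure
  -- Idempotence of `asrt r = ζ ≫ ρ` splits, because `ζ` is epic and `ρ` is monic.
  have h1 : ρ ≫ ζ = 𝟙 Y := by
    have h2 := hsharp.asrt_comp_asrt
    rw [hasrt, Category.assoc] at h2
    have h3 := hζ.cancel h2
    rw [← Category.assoc] at h3
    exact hρ.cancel (h3.trans (Category.id_comp _).symm)
  have h2 : dg ρ ≫ dg ζ = ζ ≫ ρ := by
    rw [← dg_comp hζp hρp, ← hasrt, dg_asrt]
  have h3 : dg ζ ≫ dg ρ = 𝟙 Y := by
    rw [← dg_comp hρp hζp, h1, dg_id]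
  have h4 : dg ζ = (dg ζ ≫ ζ) ≫ ρ := by
    rw [Category.assoc, ← h2, ← Category.assoc, h3, Category.id_comp]
  have h5 : (dg ζ ≫ ζ) ≫ (ρ ≫ dg ρ) = 𝟙 Y := by
    rw [← Category.assoc, ← h4, h3]
  -- Taking daggers puts the positive map `ρ ≫ dg ρ` first, where a right inverse forces it to be
  -- total and hence the identity.
  have h6 : (ρ ≫ dg ρ) ≫ (dg ζ ≫ ζ) = 𝟙 Y := by
    have := congrArg dg h5
    rwa [dg_comp (isPure_comp (isPure_dg hζp) hζp) (isPure_comp hρp (isPure_dg hρp)),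
      dg_comp (isPure_dg hζp) hζp, dg_comp hρp (isPure_dg hρp), dg_dg hζp, dg_dg hρp, dg_id]
      at this
  have h7 : ρ ≫ dg ρ = 𝟙 Y := comp_dg_eq_id hρp (IsTotal.of_comp_eq_id h6)
  -- `π` and `ρ` are comprehensions of the same `r`; the isomorphism between them is unitary by the
  -- same totality argument.
  obtain ⟨θ, θ', hθ, hθ1, hθ2⟩ := (h.of_isImage hr).exists_iso hρr
  have hθp : IsPure θ := (isComprehension_of_iso θ θ' hθ1 hθ2).isPure
  have hθp' : IsPure θ' := (isComprehension_of_iso θ' θ hθ2 hθ1).isPure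
  rw [← hθ, dg_comp hθp hρp, Category.assoc, ← Category.assoc ρ, h7, Category.id_comp]
  refine comp_dg_eq_id hθp (IsTotal.of_comp_eq_id (g := dg θ' ≫ θ') ?_)
  rw [Category.assoc, ← Category.assoc (dg θ), ← dg_comp hθp' hθp, hθ2, dg_id, Category.id_comp,
    hθ1]

/-- A pure map is, up to an isometry, determined by its predicate. -/
theorem IsPure.comp_dg {A B : C} {h : A ⟶ B} (hh : IsPure h) {r : Pred A}
    (hr : h ≫ truth B = r) : h ≫ dg h = asrt r ≫ asrt r := by
  -- The comprehension `π` is a total isometry and drops out, so `ξ` is a filter of `r`. Filters of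
  -- `r` agree up to a unitary isomorphism.
  have key : ∀ {D Y X : C} {p : Pred A} {q : Pred D} {ζ : A ⟶ Y} {ξ : A ⟶ X} {π : X ⟶ D},
      IsFilter r ζ → IsFilter p ξ → IsComprehension q π → (ξ ≫ π) ≫ truth D = r →
      (ξ ≫ π) ≫ dg (ξ ≫ π) = ζ ≫ dg ζ := by
    intro D Y X p q ζ ξ π hζ hξ hπ hp
    rw [Category.assoc, show π ≫ truth D = truth X from hπ.isTotal, hξ.truth_eq] at hp
    subst hp
    obtain ⟨θ, θ', hθ, hθ1, hθ2⟩ := hζ.exists_iso hξ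
    have hθp : IsPure θ := (isComprehension_of_iso θ θ' hθ1 hθ2).isPure
    have hθp' : IsPure θ' := (isComprehension_of_iso θ' θ hθ2 hθ1).isPure
    have h1 : θ ≫ dg θ = 𝟙 Y := by
      refine comp_dg_eq_id hθp (IsTotal.of_comp_eq_id (g := dg θ' ≫ θ') ?_)
      rw [Category.assoc, ← Category.assoc (dg θ), ← dg_comp hθp' hθp, hθ2, dg_id,
        Category.id_comp, hθ1]
    rw [dg_comp hξ.isPure hπ.isPure, Category.assoc, ← Category.assoc π, hπ.comp_dg,
      Category.id_comp, ← hθ, dg_comp hζ.isPure hθp, Category.assoc, ← Category.assoc θ, h1,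
      Category.id_comp]
  obtain ⟨Y, ζ, hζ⟩ := hasFilters r
  obtain ⟨X, p, q, ξ, π, hξ, hπ, rfl⟩ := hh
  obtain ⟨X', p', q', ξ', π', hξ', hπ', h'⟩ := isPure_asrt r
  have h1 := asrt_truth r
  rw [h'] at h1
  have h2 := key hζ hξ' hπ' h1
  rw [key hζ hξ hπ hr, ← h2, ← h', dg_asrt]

/-- For sharp `p` and `q`, the square of `q & p` is `q & (p & q)`. -/
theorem asrt_sq_of_isSharp {A : C} {p q : Pred A} (hp : IsSharp p) :
    asrt (asrt q ≫ p) ≫ (asrt q ≫ p) = asrt q ≫ asrt p ≫ q := by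
  -- Applied to `asrt q ≫ asrt p`, whose dagger is `asrt p ≫ asrt q`; the two middle copies of `asrt
  -- p` merge because `p` is sharp.
  have h := IsPure.comp_dg (isPure_comp (isPure_asrt q) (isPure_asrt p)) (r := asrt q ≫ p)
    (by rw [Category.assoc, asrt_truth])
  have h1 := congrArg (· ≫ truth A) h
  simp only [Category.assoc, asrt_truth] at h1
  rw [← h1, dg_comp (isPure_asrt q) (isPure_asrt p), dg_asrt, dg_asrt, Category.assoc, asrt_truth,
    ← Category.assoc (asrt p) (asrt p), hp.asrt_comp_asrt]

end Sequential

/-! ### Extending maps on predicates to bounded operators -/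

namespace IsUnitIntervalIso
open OrderUnitSpace
variable {C : Type u} [Category.{v} C] [HasFiniteCoproducts C] [Effectus C]
  {conv : ConvexAction (Pred (Effectus.unit (C := C)))} {A : C} {V : Type w} [OrderUnitSpace V]
  {φ : Pred A → V}

theorem nonneg (hφ : IsUnitIntervalIso conv A φ) (p : Pred A) : 0 ≤ φ p :=
  (hφ.bijOn.mapsTo trivial).1

theorem le_ounit (hφ : IsUnitIntervalIso conv A φ) (p : Pred A) : φ p ≤ ounit :=
  (hφ.bijOn.mapsTo trivial).2

theorem injective (hφ : IsUnitIntervalIso conv A φ) : Function.Injective φ :=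
  fun _ _ h => hφ.bijOn.injOn trivial trivial h

theorem exists_eq (hφ : IsUnitIntervalIso conv A φ) {x : V} (h0 : 0 ≤ x) (h1 : x ≤ ounit) :
    ∃ p, φ p = x := by
  obtain ⟨p, -, hp⟩ := hφ.bijOn.surjOn ⟨h0, h1⟩
  exact ⟨p, hp⟩

theorem map_ortho (hφ : IsUnitIntervalIso conv A φ) (p : Pred A) :
    φ (ortho p) = ounit - φ p := by
  rw [eq_sub_iff_add_eq', ← hφ.map_truth]
  exact (hφ.ovee_iff _ _ _).1 (add_ortho p)

theorem le_iff (hφ : IsUnitIntervalIso conv A φ) {p q : Pred A} : p ≤ q ↔ φ p ≤ φ q := by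
  constructor
  · rintro ⟨r, hr⟩
    rw [← (hφ.ovee_iff _ _ _).1 hr]
    exact le_add_of_nonneg_right (hφ.nonneg r)
  · intro h
    obtain ⟨r, hr⟩ := hφ.exists_eq (sub_nonneg.2 h) ((sub_le_self _ (hφ.nonneg p)).trans
      (hφ.le_ounit q))
    exact ⟨r, (hφ.ovee_iff _ _ _).2 (by rw [hr, add_sub_cancel])⟩

theorem map_zero (hφ : IsUnitIntervalIso conv A φ) : φ (0 : Pred A) = 0 := by
  have := (hφ.ovee_iff 0 0 0).1 (PCM.zero_ovee _)
  simpa using this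

theorem map_eq_zero (hφ : IsUnitIntervalIso conv A φ) {p : Pred A} : φ p = 0 ↔ p = 0 := by
  rw [← hφ.map_zero]
  exact hφ.injective.eq_iff

theorem comp_add (hφ : IsUnitIntervalIso conv A φ) (f : A ⟶ A) {p q r : Pred A}
    (h : φ r = φ p + φ q) : φ (f ≫ r) = φ (f ≫ p) + φ (f ≫ q) :=
  ((hφ.ovee_iff _ _ _).1 (FinPAC.comp_ovee f _ _ _ ((hφ.ovee_iff _ _ _).2 h.symm))).symm

theorem comp_smul (hφ : IsUnitIntervalIso conv A φ) (f : A ⟶ A) {p q : Pred A} {r : ℝ}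
    (h0 : 0 ≤ r) (h1 : r ≤ 1) (h : φ q = r • φ p) : φ (f ≫ q) = r • φ (f ≫ p) := by
  have h2 := hφ.map_act ⟨r, h0, h1⟩ p
  change _ = r • _ at h2
  rw [← h] at h2
  rw [← hφ.injective h2, ← Category.assoc, hφ.map_act]

theorem exists_smul (hφ : IsUnitIntervalIso conv A φ) {r : ℝ} (h0 : 0 ≤ r) (h1 : r ≤ 1)
    (p : Pred A) : ∃ q, φ q = r • φ p := ⟨_, hφ.map_act ⟨r, h0, h1⟩ p⟩

theorem exists_combo (hφ : IsUnitIntervalIso conv A φ) (f : A ⟶ A) {s t : ℝ} (hs : 0 ≤ s)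
    (ht : 0 ≤ t) (hst : s + t ≤ 1) (a b : Pred A) :
    ∃ z, φ z = s • φ a + t • φ b ∧ φ (f ≫ z) = s • φ (f ≫ a) + t • φ (f ≫ b) := by
  obtain ⟨a', ha⟩ := hφ.exists_smul hs (by linarith) a
  obtain ⟨b', hb⟩ := hφ.exists_smul ht (by linarith) b
  obtain ⟨z, hz⟩ := hφ.exists_eq (x := φ a' + φ b') (add_nonneg (hφ.nonneg _) (hφ.nonneg _)) (by
    rw [ha, hb]
    refine (add_le_add (smul_le_smul_of_nonneg_left (hφ.le_ounit a) hs)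
      (smul_le_smul_of_nonneg_left (hφ.le_ounit b) ht)).trans ?_
    rw [← add_smul]
    exact (smul_le_smul_of_nonneg_right hst ounit_nonneg).trans (one_smul _ _).le)
  exact ⟨z, by rw [hz, ha, hb], by
    rw [hφ.comp_add f hz, hφ.comp_smul f hs (by linarith) ha, hφ.comp_smul f ht (by linarith) hb]⟩

theorem exists_scaled (hφ : IsUnitIntervalIso conv A φ) (f : A ⟶ A) {s t L : ℝ} (hs : 0 ≤ s)
    (ht : 0 ≤ t) (hL : 0 < L) (hst : s + t ≤ L) (a b : Pred A) :
    ∃ z, s • φ a + t • φ b = L • φ z ∧ s • φ (f ≫ a) + t • φ (f ≫ b) = L • φ (f ≫ z) := by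
  obtain ⟨z, h1, h2⟩ := hφ.exists_combo f (s := s / L) (t := t / L) (by positivity) (by positivity)
    (by rw [← add_div]; exact (div_le_one hL).2 hst) a b
  refine ⟨z, ?_, ?_⟩
  · rw [h1, smul_add, smul_smul, smul_smul, mul_div_cancel₀ _ hL.ne', mul_div_cancel₀ _ hL.ne']
  · rw [h2, smul_add, smul_smul, smul_smul, mul_div_cancel₀ _ hL.ne', mul_div_cancel₀ _ hL.ne']

theorem exists_eq_smul_of_nonneg (hφ : IsUnitIntervalIso conv A φ) {v : V} (hv : 0 ≤ v) :
    ∃ (N : ℝ) (a : Pred A), 0 < N ∧ v = N • φ a := by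
  have hN : 0 < ‖v‖ + 1 := by positivity
  obtain ⟨a, ha⟩ := hφ.exists_eq (x := (‖v‖ + 1)⁻¹ • v) (smul_nonneg (by positivity) hv) (by
    have h1 : v ≤ (‖v‖ + 1) • ounit := (le_norm_smul v).trans
      (smul_le_smul_of_nonneg_right (by linarith) ounit_nonneg)
    have := smul_le_smul_of_nonneg_left h1 (inv_nonneg.2 hN.le)
    rwa [smul_smul, inv_mul_cancel₀ hN.ne', one_smul] at this)
  exact ⟨_, a, hN, by rw [ha, smul_smul, mul_inv_cancel₀ hN.ne', one_smul]⟩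

theorem exists_eq_sub (hφ : IsUnitIntervalIso conv A φ) (v : V) :
    ∃ (s t : ℝ) (a b : Pred A), 0 ≤ s ∧ 0 ≤ t ∧ v = s • φ a - t • φ b := by
  obtain ⟨N, a, hN, h⟩ := hφ.exists_eq_smul_of_nonneg (v := v + ‖v‖ • ounit) (by
    rw [← neg_le_iff_add_nonneg]
    exact neg_norm_smul_le v)
  exact ⟨N, ‖v‖, a, truth A, hN.le, norm_nonneg v, by rw [← h, hφ.map_truth, add_sub_cancel_right]⟩

/-- Well-definedness of the linear extension. Moving negative terms across leaves nonnegative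
combinations, and dividing by a large `L` makes them predicates, on which `f` acts additively. -/
theorem combo_congr (hφ : IsUnitIntervalIso conv A φ) (f : A ⟶ A) {s t s' t' : ℝ} (hs : 0 ≤ s)
    (ht : 0 ≤ t) (hs' : 0 ≤ s') (ht' : 0 ≤ t') {a b a' b' : Pred A}
    (h : s • φ a - t • φ b = s' • φ a' - t' • φ b') :
    s • φ (f ≫ a) - t • φ (f ≫ b) = s' • φ (f ≫ a') - t' • φ (f ≫ b') := by
  set L := s + t + s' + t' + 1 with hL
  have hL0 : 0 < L := by positivity
  obtain ⟨z, h1, h2⟩ := hφ.exists_scaled f hs ht' hL0 (by linarith) a b'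
  obtain ⟨z', h1', h2'⟩ := hφ.exists_scaled f hs' ht hL0 (by linarith) a' b
  rw [sub_eq_sub_iff_add_eq_add, h1, h1'] at h
  rw [sub_eq_sub_iff_add_eq_add, h2, h2', hφ.injective (smul_right_injective V hL0.ne' h)]

theorem exists_linearMap (hφ : IsUnitIntervalIso conv A φ) (f : A ⟶ A) :
    ∃ T : V →ₗ[ℝ] V, ∀ p, T (φ p) = φ (f ≫ p) := by
  choose s t a b hs ht h using hφ.exists_eq_sub
  have key : ∀ (v : V) (s' t' : ℝ) (a' b' : Pred A), 0 ≤ s' → 0 ≤ t' →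
      v = s' • φ a' - t' • φ b' →
      s v • φ (f ≫ a v) - t v • φ (f ≫ b v) = s' • φ (f ≫ a') - t' • φ (f ≫ b') :=
    fun v s' t' a' b' hs' ht' hv =>
      hφ.combo_congr f (hs v) (ht v) hs' ht' (by rw [← h v, ← hv])
  refine ⟨{ toFun := fun v => s v • φ (f ≫ a v) - t v • φ (f ≫ b v),
            map_add' := fun v w => ?_, map_smul' := fun c v => ?_ }, fun p => ?_⟩
  · obtain ⟨z, h1, h2⟩ := hφ.exists_scaled f (hs v) (hs w) (L := s v + s w + 1)
      (by linarith [hs v, hs w]) (by linarith) (a v) (a w)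
    obtain ⟨z', h1', h2'⟩ := hφ.exists_scaled f (ht v) (ht w) (L := t v + t w + 1)
      (by linarith [ht v, ht w]) (by linarith) (b v) (b w)
    rw [key (v + w) (s v + s w + 1) (t v + t w + 1) z z' (by linarith [hs v, hs w]) (by linarith [ht v, ht w])
      (by rw [← h1, ← h1', add_sub_add_comm, ← h, ← h]), ← h2, ← h2', add_sub_add_comm]
  · rcases le_total 0 c with hc | hc
    · rw [key (c • v) (c * s v) (c * t v) (a v) (b v) (mul_nonneg hc (hs v)) (mul_nonneg hc (ht v))
        (by rw [mul_smul, mul_smul, ← smul_sub, ← h]), mul_smul, mul_smul, ← smul_sub,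
        RingHom.id_apply]
    · have hc' := neg_nonneg.2 hc
      rw [key (c • v) (-c * t v) (-c * s v) (b v) (a v) (mul_nonneg hc' (ht v))
        (mul_nonneg hc' (hs v)) (by
          rw [mul_smul, mul_smul, ← smul_sub, neg_smul, ← smul_neg, neg_sub, ← h]), mul_smul,
        mul_smul, ← smul_sub, neg_smul, ← smul_neg, neg_sub, RingHom.id_apply]
  · have := key (φ p) 1 0 p p zero_le_one le_rfl (by simp)
    simpa using this

theorem ext_linearMap (hφ : IsUnitIntervalIso conv A φ) {S T : V →L[ℝ] V}
    (h : ∀ p, S (φ p) = T (φ p)) : S = T := by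
  ext v
  obtain ⟨s, t, a, b, -, -, rfl⟩ := hφ.exists_eq_sub v
  simp [h]

theorem nonneg_of_isInduced (hφ : IsUnitIntervalIso conv A φ) {f : A ⟶ A} {T : V →ₗ[ℝ] V}
    (hT : ∀ p, T (φ p) = φ (f ≫ p)) {v : V} (hv : 0 ≤ v) : 0 ≤ T v := by
  obtain ⟨N, a, hN, rfl⟩ := hφ.exists_eq_smul_of_nonneg hv
  rw [map_smul, hT]
  exact smul_nonneg hN.le (hφ.nonneg _)

/-- The extension is positive and maps the unit below the unit, so its norm is at most `1`. -/
theorem exists_isInduced (hφ : IsUnitIntervalIso conv A φ) (f : A ⟶ A) :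
    ∃ T : V →L[ℝ] V, IsInduced φ f T := by
  obtain ⟨T, hT⟩ := hφ.exists_linearMap f
  have hmono : ∀ {v w : V}, v ≤ w → T v ≤ T w := fun {v w} h => by
    rw [← sub_nonneg, ← map_sub]
    exact hφ.nonneg_of_isInduced hT (sub_nonneg.2 h)
  refine ⟨T.mkContinuous 1 fun v => ?_, hT⟩
  have h1 : T ounit ≤ ounit := by
    rw [← hφ.map_truth, hT, hφ.map_truth]
    exact hφ.le_ounit _
  have h2 : ‖v‖ • T ounit ≤ ‖v‖ • ounit := smul_le_smul_of_nonneg_left h1 (norm_nonneg v)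
  rw [one_mul]
  refine norm_le (norm_nonneg v) ?_ ?_
  · refine (neg_le_neg h2).trans ?_
    rw [← map_smul, ← map_neg]
    exact hmono (neg_norm_smul_le v)
  · refine le_trans ?_ h2
    rw [← map_smul]
    exact hmono (le_norm_smul v)

theorem existsUnique_isInduced (hφ : IsUnitIntervalIso conv A φ) (f : A ⟶ A) :
    ∃! T : V →L[ℝ] V, IsInduced φ f T := by
  obtain ⟨T, hT⟩ := hφ.exists_isInduced f
  exact ⟨T, hT, fun S hS => hφ.ext_linearMap fun p => by rw [hS, hT]⟩

/-- The bounded linear extension of `p ↦ p ∘ f`. -/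
noncomputable def op (hφ : IsUnitIntervalIso conv A φ) (f : A ⟶ A) : V →L[ℝ] V :=
  (hφ.exists_isInduced f).choose

theorem op_apply (hφ : IsUnitIntervalIso conv A φ) (f : A ⟶ A) (p : Pred A) :
    hφ.op f (φ p) = φ (f ≫ p) := (hφ.exists_isInduced f).choose_spec p

theorem eq_op (hφ : IsUnitIntervalIso conv A φ) {f : A ⟶ A} {T : V →L[ℝ] V}
    (hT : IsInduced φ f T) : T = hφ.op f := hφ.ext_linearMap fun p => by rw [hT, hφ.op_apply]

theorem op_nonneg (hφ : IsUnitIntervalIso conv A φ) (f : A ⟶ A) {v : V} (hv : 0 ≤ v) :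
    0 ≤ hφ.op f v := hφ.nonneg_of_isInduced (T := (hφ.op f : V →ₗ[ℝ] V)) (hφ.op_apply f) hv

theorem op_mono (hφ : IsUnitIntervalIso conv A φ) (f : A ⟶ A) {v w : V} (h : v ≤ w) :
    hφ.op f v ≤ hφ.op f w := by
  rw [← sub_nonneg, ← map_sub]
  exact hφ.op_nonneg f (sub_nonneg.2 h)

theorem op_ounit (hφ : IsUnitIntervalIso conv A φ) (f : A ⟶ A) :
    hφ.op f ounit = φ (f ≫ truth A) := by rw [← hφ.map_truth, hφ.op_apply]

theorem exists_maximal (hφ : IsUnitIntervalIso conv A φ) (hn : IsNormalEffectus C)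
    {P : Pred A → Prop} {a : Pred A} (ha : P a)
    (hsup : ∀ (S : Set (Pred A)) (s : Pred A), DirectedOn (· ≤ ·) S → S.Nonempty →
      (∀ x ∈ S, P x) → IsLUB S s → P s) :
    ∃ m, P m ∧ ∀ b, P b → φ m ≤ φ b → b = m := by
  -- Zorn's lemma is applied to the image in `V`, where the order is a `PartialOrder`; chains pull
  -- back to directed sets of predicates.
  obtain ⟨_, -, ⟨⟨m, hm, rfl⟩, hmax⟩⟩ := zorn_le_nonempty₀ (φ '' {x | P x}) (by
    intro c hc hchain y hy
    obtain ⟨s, hs⟩ := hn.directedComplete A (φ ⁻¹' c) (by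
      intro x hx y hy
      rcases hchain.total hx hy with h | h
      · exact ⟨y, hy, hφ.le_iff.2 h, pcm_le_refl y⟩
      · exact ⟨x, hx, pcm_le_refl x, hφ.le_iff.2 h⟩)
    have hP : ∀ x, φ x ∈ c → P x := fun x hx => by
      obtain ⟨x', hx', h⟩ := hc hx
      rwa [← hφ.injective h]
    refine ⟨φ s, ⟨s, hsup (φ ⁻¹' c) s ?_ ?_ hP hs, rfl⟩, fun z hz => ?_⟩
    · intro x hx y hy
      rcases hchain.total hx hy with h | h
      · exact ⟨y, hy, hφ.le_iff.2 h, pcm_le_refl y⟩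
      · exact ⟨x, hx, pcm_le_refl x, hφ.le_iff.2 h⟩
    · obtain ⟨y', -, rfl⟩ := hc hy
      exact ⟨y', hy⟩
    · obtain ⟨z', -, rfl⟩ := hc hz
      exact hφ.le_iff.1 (hs.1 hz)) (φ a) ⟨a, ha, rfl⟩
  refine ⟨m, hm, fun b hb hmb => hφ.injective ?_⟩
  exact le_antisymm (hmax ⟨b, hb, rfl⟩ hmb) hmb

end IsUnitIntervalIso

/-! ### Commutation in the sequential product -/

section SequentialProduct
open SequentialEffectus
variable {C : Type u} [Category.{v} C] [HasFiniteCoproducts C] [Effectus C] [SequentialEffectus C]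
  {A : C}

/-- The sequential product `a & b = b ∘ asrt_a`. -/
def sq (a b : Pred A) : Pred A := asrt a ≫ b

/-- Two predicates commute for the sequential product. -/
def Comm (a b : Pred A) : Prop := sq a b = sq b a

theorem Comm.symm {a b : Pred A} (h : Comm a b) : Comm b a := Eq.symm h

theorem Comm.refl (a : Pred A) : Comm a a := rfl

theorem Comm.ortho {a b : Pred A} (h : Comm a b) : Comm a (ortho b) :=
  (sequential A).commute_ortho a b h

theorem Comm.sq {a b c : Pred A} (ha : Comm c a) (hb : Comm c b) : Comm c (sq a b) :=
  (sequential A).commute_seq a b c ha hb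

theorem Comm.sup {a s : Pred A} {S : Set (Pred A)} (hS : DirectedOn (· ≤ ·) S) (hs : IsLUB S s)
    (h : ∀ x ∈ S, Comm a x) : Comm a s :=
  (sequential A).commute_sup a S s hS hs h

theorem sq_eq_zero_symm {a b : Pred A} (h : sq a b = 0) : sq b a = 0 :=
  (sequential A).seq_eq_zero a b h

theorem comm_of_sq_eq_zero {a b : Pred A} (h : sq a b = 0) : Comm a b :=
  h.trans (sq_eq_zero_symm h).symm

theorem sq_truth (a : Pred A) : sq a (truth A) = a := asrt_truth a

theorem sq_le (a b : Pred A) : sq a b ≤ a := by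
  conv_rhs => rw [← sq_truth a]
  exact comp_le_comp _ (le_truth b)

theorem sq_mono (a : Pred A) {b c : Pred A} (h : b ≤ c) : sq a b ≤ sq a c := comp_le_comp _ h

omit [SequentialEffectus C] in
theorem pred_eq_zero_of_le {a : Pred A} (h : a ≤ 0) : a = 0 :=
  (Effectus.isEffectAlgebra A).eq_zero_of_le_zero h

theorem sq_eq_self_iff {a b : Pred A} : sq a b = a ↔ sq a (SeqEff.ortho b) = 0 := by
  have := comp_eq_truth_iff (asrt a) b
  rwa [asrt_truth] at this

theorem IsCeil.sq_eq_zero {u c y : Pred A} (h : IsCeil u c) (hu : sq u y = 0) : sq y c = 0 :=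
  h.comp_eq_zero (sq_eq_zero_symm hu)

theorem IsSharp.sq_self {p : Pred A} (h : IsSharp p) : sq p p = p := h.asrt_comp_self

theorem IsSharp.sq_ortho_self {p : Pred A} (h : IsSharp p) : sq (SeqEff.ortho p) p = 0 := by
  have := sq_eq_self_iff.1 h.ortho.sq_self
  rwa [ortho_ortho] at this

/-- From `p⊥ & a ≤ p⊥ & p = 0` it follows that `a & p⊥ = 0`; thus `a` commutes with `p⊥`, hence with
`p`, and `a & p = a`. -/
theorem IsSharp.sq_of_le {p a : Pred A} (h : IsSharp p) (ha : a ≤ p) : sq p a = a ∧ sq a p = a := by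
  have h1 : sq (SeqEff.ortho p) a = 0 := by
    refine pred_eq_zero_of_le ?_
    rw [← h.sq_ortho_self]
    exact sq_mono _ ha
  have h2 := sq_eq_zero_symm h1
  have h3 : Comm a p := by
    have := (comm_of_sq_eq_zero h2).ortho
    rwa [ortho_ortho] at this
  have h4 := sq_eq_self_iff.2 h2
  exact ⟨h3.symm.trans h4, h4⟩

theorem IsSharp.comm_of_le {p a : Pred A} (h : IsSharp p) (ha : a ≤ p) : Comm p a :=
  (h.sq_of_le ha).1.trans (h.sq_of_le ha).2.symm

/-- As `c` is the image of `asrt u`, `u & c⊥ = 0`; so `u` and `c` commute and `u = u & c = c & u ≤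
c`. -/
theorem IsCeil.le {u c : Pred A} (h : IsCeil u c) : u ≤ c := by
  have h1 := isImage_asrt_iff u c |>.2 h
  have h2 : sq u (SeqEff.ortho c) = 0 := sq_eq_self_iff.1 (h1.comp_eq.trans (asrt_truth u))
  have h3 : sq c u = u := by
    have h4 := sq_eq_zero_symm h2
    have h5 : Comm u c := by
      have := (comm_of_sq_eq_zero h2).ortho
      rwa [ortho_ortho] at this
    exact h5.symm.trans (sq_eq_self_iff.2 h2)
  rw [← h3]
  exact sq_le _ _

end SequentialProduct

/-! ### Spectral theory: enough sharp predicates -/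

namespace IsUnitIntervalIso
open OrderUnitSpace SequentialEffectus
variable {C : Type u} [Category.{v} C] [HasFiniteCoproducts C] [Effectus C] [SequentialEffectus C]
  {conv : ConvexAction (Pred (Effectus.unit (C := C)))} {A : C} {V : Type w} [OrderUnitSpace V]
  {φ : Pred A → V}

theorem comm_add (hφ : IsUnitIntervalIso conv A φ) {a b c d : Pred A} (ha : Comm c a)
    (hb : Comm c b) (h : φ d = φ a + φ b) : Comm c d :=
  (sequential A).commute_ovee a b c d ha hb ((hφ.ovee_iff _ _ _).2 h.symm)

/-- Differences become sums after orthosupplementation: `d⊥ = b⊥ + a`. -/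
theorem comm_sub (hφ : IsUnitIntervalIso conv A φ) {a b c d : Pred A} (ha : Comm c a)
    (hb : Comm c b) (h : φ d = φ b - φ a) : Comm c d := by
  have h1 : Comm c (ortho d) := by
    refine hφ.comm_add hb.ortho ha ?_
    rw [hφ.map_ortho, hφ.map_ortho, h]
    abel
  have := h1.ortho
  rwa [ortho_ortho] at this

theorem sq_add (hφ : IsUnitIntervalIso conv A φ) (a : Pred A) {b c d : Pred A}
    (h : φ d = φ b + φ c) : φ (sq a d) = φ (sq a b) + φ (sq a c) := hφ.comp_add _ h

theorem sq_smul (hφ : IsUnitIntervalIso conv A φ) (a : Pred A) {b c : Pred A} {r : ℝ}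
    (h0 : 0 ≤ r) (h1 : r ≤ 1) (h : φ c = r • φ b) : φ (sq a c) = r • φ (sq a b) :=
  hφ.comp_smul _ h0 h1 h

theorem map_sq_le_left (hφ : IsUnitIntervalIso conv A φ) (a b : Pred A) : φ (sq a b) ≤ φ a :=
  hφ.le_iff.1 (sq_le a b)

theorem map_sq_le_right (hφ : IsUnitIntervalIso conv A φ) {a b : Pred A} (h : Comm a b) :
    φ (sq a b) ≤ φ b := by
  rw [show sq a b = sq b a from h]
  exact hφ.map_sq_le_left b a

omit [SequentialEffectus C] in
theorem isLUB_le (hφ : IsUnitIntervalIso conv A φ) {S : Set (Pred A)} {s : Pred A}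
    (hs : IsLUB S s) {v : V} (h0 : 0 ≤ v) (h1 : v ≤ ounit) (h : ∀ x ∈ S, φ x ≤ v) : φ s ≤ v := by
  obtain ⟨p, rfl⟩ := hφ.exists_eq h0 h1
  exact hφ.le_iff.1 (hs.2 fun x hx => hφ.le_iff.2 (h x hx))

/-- Either a predicate dominates half of a nonzero sharp predicate, or its double is a predicate. -/
theorem exists_sharp_or_double_le (hφ : IsUnitIntervalIso conv A φ) (r : Pred A) :
    (∃ e, IsSharp e ∧ e ≠ 0 ∧ φ e ≤ (2 : ℝ) • φ r) ∨ (2 : ℝ) • φ r ≤ ounit := by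
  have hu0 : (0 : V) ≤ ounit := ounit_nonneg
  -- `b` plays the role of `min r (1/2)`. With `h = 2 b`, `u = 1 - h` and `v = r - b`, the goal is
  -- that `u` and `v` annihilate each other unless a sharp predicate appears.
  obtain ⟨b, ⟨hbr, hbr', hb1⟩, hmax⟩ := hφ.exists_maximal (SequentialEffectus.normal (C := C))
    (P := fun b => Comm r b ∧ φ b ≤ φ r ∧ φ b ≤ (1 / 2 : ℝ) • ounit) (a := 0)
    ⟨comm_of_sq_eq_zero (FinPAC.comp_zero _), by rw [hφ.map_zero]; exact hφ.nonneg r, by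
      rw [hφ.map_zero]; exact smul_nonneg (by norm_num) hu0⟩
    (fun S s hS _ hP hs => ⟨Comm.sup hS hs fun x hx => (hP x hx).1,
      hφ.isLUB_le hs (hφ.nonneg r) (hφ.le_ounit r) fun x hx => (hP x hx).2.1,
      hφ.isLUB_le hs (smul_nonneg (by norm_num) hu0)
        ((smul_le_smul_of_nonneg_right (by norm_num) hu0).trans (one_smul ℝ _).le)
        fun x hx => (hP x hx).2.2⟩)
  obtain ⟨h, hh⟩ := hφ.exists_eq (x := φ b + φ b) (add_nonneg (hφ.nonneg b) (hφ.nonneg b)) (by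
    refine (add_le_add hb1 hb1).trans (le_of_eq ?_)
    rw [← add_smul]
    norm_num)
  obtain ⟨v, hv⟩ := hφ.exists_eq (x := φ r - φ b) (sub_nonneg.2 hbr')
    ((sub_le_self _ (hφ.nonneg b)).trans (hφ.le_ounit r))
  set u := ortho h with hu
  -- A substitute for the scalar `1/2`: it commutes with `r` and `2 w ≤ 1`. Scalars themselves are
  -- unavailable here, since `comm_scalar` relies on this lemma.
  set w := sq r (ortho r) with hw
  have hrh : Comm r h := hφ.comm_add hbr hbr hh
  have hru : Comm r u := hrh.ortho
  have hrv : Comm r v := hφ.comm_sub hbr (Comm.refl r) hv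
  have hrw : Comm r w := (Comm.refl r).sq (Comm.refl r).ortho
  have hbh : Comm h b := (hφ.comm_add (Comm.refl b) (Comm.refl b) hh).symm
  have hvu : Comm v u := (hφ.comm_sub hbh hrh.symm hv).symm.ortho
  set x := sq u (sq v w) with hx
  have hrx : Comm r x := hru.sq (hrv.sq hrw)
  have hxv : φ x ≤ φ v := by
    have h1 := hφ.le_iff.1 (sq_mono u (sq_le v w))
    exact h1.trans (hφ.map_sq_le_right hvu.symm)
  have hw2 : φ w + φ w ≤ ounit := by
    have h1 : φ w ≤ φ r := hφ.map_sq_le_left r _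
    have h2 : φ w ≤ φ (ortho r) := hφ.map_sq_le_right (Comm.refl r).ortho
    rw [hφ.map_ortho] at h2
    refine (add_le_add h1 h2).trans (le_of_eq ?_)
    abel
  have hxu : φ x + φ x ≤ φ u := by
    obtain ⟨w2, hw2'⟩ := hφ.exists_eq (add_nonneg (hφ.nonneg w) (hφ.nonneg w)) hw2
    rw [← hφ.sq_add u (hφ.sq_add v hw2')]
    exact hφ.map_sq_le_left _ _
  have hub : φ u = ounit - (φ b + φ b) := by rw [hu, hφ.map_ortho, hh]
  have hhalf : φ b + φ x ≤ (1 / 2 : ℝ) • ounit := by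
    rw [hub, le_sub_iff_add_le] at hxu
    have h1 : (2 : ℝ) • (φ b + φ x) ≤ ounit := by
      refine le_trans (le_of_eq ?_) hxu
      rw [two_smul]
      abel
    have h2 := smul_le_smul_of_nonneg_left h1 (show (0 : ℝ) ≤ 1 / 2 by norm_num)
    rwa [smul_smul, show (1 / 2 : ℝ) * 2 = 1 by norm_num, one_smul] at h2
  have hhalf1 : (1 / 2 : ℝ) • (ounit : V) ≤ ounit :=
    (smul_le_smul_of_nonneg_right (by norm_num) hu0).trans (one_smul ℝ _).le
  obtain ⟨b', hb'⟩ := hφ.exists_eq (add_nonneg (hφ.nonneg b) (hφ.nonneg x))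
    (hhalf.trans hhalf1)
  -- Since `2 x ≤ u` and `x ≤ v`, the sum `b + x` is still admissible, contradicting maximality
  -- unless `x = 0`.
  have hx0 : x = 0 := by
    have h1 := hmax b' ⟨hφ.comm_add hbr hrx hb', by
      rw [hb', ← le_sub_iff_add_le', ← hv]
      exact hxv, by rw [hb']; exact hhalf⟩ (by rw [hb']; exact le_add_of_nonneg_right (hφ.nonneg x))
    rw [h1] at hb'
    rw [← hφ.map_eq_zero]
    simpa using hb'
  -- If the ceiling `c` is not `1`, then `c⊥` is sharp, nonzero and below `u⊥ = 2 b ≤ 2 r`.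
  obtain ⟨c, hc⟩ := exists_isCeil u
  have h1 : sq (sq v w) c = 0 := hc.sq_eq_zero hx0
  by_cases he : ortho c = 0
  swap
  · refine Or.inl ⟨ortho c, hc.isSharp.ortho, he, ?_⟩
    have h2 := hφ.le_iff.1 hc.le
    rw [hu, hφ.map_ortho, hh] at h2
    rw [hφ.map_ortho, two_smul, sub_le_comm]
    exact (sub_le_sub_left (add_le_add hbr' hbr') _).trans h2
  have hc1 : c = truth A := by
    rw [← ortho_ortho c, he]
    refine hφ.injective ?_
    rw [hφ.map_ortho, hφ.map_zero, hφ.map_truth, sub_zero]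
  rw [hc1, sq_truth] at h1
  have h2 : sq (sq v r) (ortho r) = 0 := by
    have h3 := (sequential A).seq_assoc v r hrv.symm (ortho r)
    exact h3.symm.trans h1
  -- Likewise, if `d` is not `1`, then `d⊥` is sharp, nonzero and below `r`.
  obtain ⟨d, hd⟩ := exists_isCeil (ortho r)
  have h3 : sq (sq v r) d = 0 := hd.sq_eq_zero (sq_eq_zero_symm h2)
  by_cases he' : ortho d = 0
  swap
  · refine Or.inl ⟨ortho d, hd.isSharp.ortho, he', ?_⟩
    have h4 := hφ.le_iff.1 hd.le
    rw [hφ.map_ortho] at h4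
    rw [hφ.map_ortho, two_smul]
    exact (sub_le_comm.1 h4).trans (le_add_of_nonneg_right (hφ.nonneg r))
  have hd1 : d = truth A := by
    rw [← ortho_ortho d, he']
    refine hφ.injective ?_
    rw [hφ.map_ortho, hφ.map_zero, hφ.map_truth, sub_zero]
  rw [hd1, sq_truth] at h3
  have hvr : v ≤ r := hφ.le_iff.2 (by rw [hv]; exact sub_le_self _ (hφ.nonneg b))
  -- Both ceilings are `1`, so `v & r = 0`; as `v ≤ r`, this forces `v & v = 0`, then `v = 0`, so
  -- that `r = b ≤ 1/2`.
  have h4 : sq v v = 0 := pred_eq_zero_of_le (h3 ▸ sq_mono v hvr)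
  obtain ⟨k, hk⟩ := exists_isCeil v
  have h5 : v = 0 := by
    rw [← (hk.isSharp.sq_of_le hk.le).2]
    exact hk.sq_eq_zero h4
  right
  rw [h5, hφ.map_zero, eq_comm, sub_eq_zero] at hv
  rw [hv, two_smul, ← hh]
  exact hφ.le_ounit h

/-- Doubling `r` must at some stage meet half of a sharp predicate; otherwise `2 ^ n • φ r ≤ 1` for
all `n`, and `r = 0` by the Archimedean property. -/
theorem exists_sharp_le (hφ : IsUnitIntervalIso conv A φ) {r : Pred A} (hr : r ≠ 0) :
    ∃ (e : Pred A) (μ : ℝ), IsSharp e ∧ e ≠ 0 ∧ 0 < μ ∧ μ ≤ 1 ∧ μ • φ e ≤ φ r := by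
  by_contra! hcon
  have h1 : ∀ n : ℕ, (2 ^ n : ℝ) • φ r ≤ ounit := by
    intro n
    induction n with
    | zero => simpa using hφ.le_ounit r
    | succ n ih =>
      obtain ⟨r', hr'⟩ := hφ.exists_eq (smul_nonneg (by positivity) (hφ.nonneg r)) ih
      rcases hφ.exists_sharp_or_double_le r' with ⟨e, he, he0, hle⟩ | hle
      · refine absurd ?_ (hcon e ((2 ^ (n + 1))⁻¹) he he0 (by positivity)
          (inv_le_one_of_one_le₀ (one_le_pow₀ one_le_two)))
        rw [hr', smul_smul, ← pow_succ'] at hle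
        have := smul_le_smul_of_nonneg_left hle (show (0 : ℝ) ≤ (2 ^ (n + 1))⁻¹ by positivity)
        rwa [smul_smul, inv_mul_cancel₀ (by positivity), one_smul] at this
      · rwa [hr', smul_smul, ← pow_succ'] at hle
  refine hr (hφ.map_eq_zero.1 (le_antisymm ?_ (hφ.nonneg r)))
  refine le_of_forall_pos fun ε hε => ?_
  obtain ⟨n, hn⟩ := exists_nat_gt ε⁻¹
  have h2 : ε⁻¹ ≤ (2 : ℝ) ^ n := hn.le.trans (by exact_mod_cast n.lt_two_pow_self.le)
  have h3 := smul_le_smul_of_nonneg_left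
    ((smul_le_smul_of_nonneg_right h2 (hφ.nonneg r)).trans (h1 n)) hε.le
  rwa [smul_smul, mul_inv_cancel₀ hε.ne', one_smul, ← zero_add (ε • _)] at h3

/-- Induction along sums of multiples of sharp predicates and directed suprema. -/
theorem sharp_induction (hφ : IsUnitIntervalIso conv A φ) {P : Pred A → Prop} (a : Pred A)
    (zero : P 0)
    (smul_sharp : ∀ (e d : Pred A) (μ : ℝ), IsSharp e → 0 < μ → μ ≤ 1 → φ d = μ • φ e →
      φ d ≤ φ a → P d)
    (add : ∀ b c d, P b → P c → φ d = φ b + φ c → P d)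
    (sup : ∀ (S : Set (Pred A)) (s : Pred A), DirectedOn (· ≤ ·) S → S.Nonempty →
      (∀ x ∈ S, P x) → IsLUB S s → P s) : P a := by
  -- A maximal predicate below `a` with property `P` must be `a`: a nonzero remainder would dominate
  -- a multiple of a sharp predicate that could be added.
  obtain ⟨m, ⟨hma, hPm⟩, hmax⟩ := hφ.exists_maximal (SequentialEffectus.normal (C := C))
    (P := fun b => φ b ≤ φ a ∧ P b) (a := 0) ⟨by rw [hφ.map_zero]; exact hφ.nonneg a, zero⟩
    (fun S s hS hne hP hs =>
      ⟨hφ.isLUB_le hs (hφ.nonneg a) (hφ.le_ounit a) fun x hx => (hP x hx).1,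
        sup S s hS hne (fun x hx => (hP x hx).2) hs⟩)
  obtain ⟨r, hr⟩ := hφ.exists_eq (sub_nonneg.2 hma)
    ((sub_le_self _ (hφ.nonneg m)).trans (hφ.le_ounit a))
  by_cases hr0 : r = 0
  · rw [hr0, hφ.map_zero, eq_comm, sub_eq_zero] at hr
    rwa [hφ.injective hr]
  obtain ⟨e, μ, he, he0, hμ, hμ1, hle⟩ := hφ.exists_sharp_le hr0
  obtain ⟨d, hd⟩ := hφ.exists_smul hμ.le hμ1 e
  rw [hr, le_sub_iff_add_le', ← hd] at hle
  obtain ⟨t, ht⟩ := hφ.exists_eq (add_nonneg (hφ.nonneg m) (hφ.nonneg d))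
    (hle.trans (hφ.le_ounit a))
  have hPd : P d := smul_sharp e d μ he hμ hμ1 hd
    ((le_add_of_nonneg_left (hφ.nonneg m)).trans hle)
  have h1 := hmax t ⟨by rw [ht]; exact hle, add m d t hPm hPd ht⟩
    (by rw [ht]; exact le_add_of_nonneg_right (hφ.nonneg d))
  rw [h1] at ht
  have h2 : φ d = 0 := by simpa using ht
  rw [hd, smul_eq_zero_iff_right hμ.ne', hφ.map_eq_zero] at h2
  exact absurd h2 he0

/-- Scalar multiples of the truth commute with every predicate. -/
theorem comm_scalar (hφ : IsUnitIntervalIso conv A φ) {l : Pred A} {r : ℝ} (h0 : 0 ≤ r)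
    (h1 : r ≤ 1) (hl : φ l = r • ounit) (a : Pred A) : Comm l a := by
  refine hφ.sharp_induction (P := Comm l) a (comm_of_sq_eq_zero (FinPAC.comp_zero _)) ?_
    (fun b c d hb hc hd => hφ.comm_add hb hc hd)
    (fun S s hS _ hP hs => Comm.sup hS hs hP)
  intro e d μ he hμ hμ1 hd _
  have hle : ∀ p q : Pred A, φ q = r • φ p → q ≤ p := fun p q h => hφ.le_iff.2 (by
    rw [h]
    exact (smul_le_smul_of_nonneg_right h1 (hφ.nonneg p)).trans (one_smul ℝ _).le)
  -- The scalar splits as `r e + r e⊥`, and `e` commutes with each part because one lies below `e`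
  -- and the other below `e⊥`.
  obtain ⟨k, hk⟩ := hφ.exists_smul h0 h1 e
  obtain ⟨k', hk'⟩ := hφ.exists_smul h0 h1 (ortho e)
  have hek : Comm e k := he.comm_of_le (hle _ _ hk)
  have hek' : Comm e k' := by
    have := (he.ortho.comm_of_le (hle _ _ hk')).symm.ortho
    rw [ortho_ortho] at this
    exact this.symm
  have hel : Comm e l := hφ.comm_add hek hek' (by
    rw [hl, hk, hk', hφ.map_ortho, ← smul_add, add_sub_cancel])
  refine hφ.injective ?_
  have hl' : φ l = r • φ (truth A) := by rw [hl, hφ.map_truth]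
  rw [hφ.sq_smul l hμ.le hμ1 hd, hφ.sq_smul d h0 h1 hl', sq_truth, hd,
    ← show sq e l = sq l e from hel, hφ.sq_smul e h0 h1 hl', sq_truth, smul_comm]

/-- The multiple `r a` is the sequential product of `a` with the scalar `r`, and both factors
commute with `c`. -/
theorem comm_smul (hφ : IsUnitIntervalIso conv A φ) {a b c : Pred A} {r : ℝ} (h0 : 0 ≤ r)
    (h1 : r ≤ 1) (h : Comm c a) (hb : φ b = r • φ a) : Comm c b := by
  obtain ⟨l, hl⟩ := hφ.exists_smul h0 h1 (truth A)
  have hl' : φ l = r • ounit := by rw [hl, hφ.map_truth]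
  have h2 : Comm c (sq a l) := h.sq (hφ.comm_scalar h0 h1 hl' c).symm
  have h3 : sq a l = b := hφ.injective (by rw [hφ.sq_smul a h0 h1 hl, sq_truth, hb])
  rwa [h3] at h2

theorem scalar_sq (hφ : IsUnitIntervalIso conv A φ) {l : Pred A} {r : ℝ} (h0 : 0 ≤ r)
    (h1 : r ≤ 1) (hl : φ l = r • ounit) (a : Pred A) : φ (sq l a) = r • φ a := by
  rw [show sq l a = sq a l from hφ.comm_scalar h0 h1 hl a,
    hφ.sq_smul a h0 h1 (b := truth A) (by rw [hl, hφ.map_truth]), sq_truth]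

/-- Spectral cut of a predicate at level `l`. -/
theorem exists_spectral_cut (hφ : IsUnitIntervalIso conv A φ) (r : Pred A) {l : ℝ} (h0 : 0 < l)
    (h1 : l ≤ 1) : ∃ e, IsSharp e ∧ Comm e r ∧ l • φ e ≤ φ r ∧
      φ (sq (ortho e) r) ≤ l • φ (ortho e) := by
  obtain ⟨t, ht⟩ := hφ.exists_smul h0.le h1 (truth A)
  rw [hφ.map_truth] at ht
  -- `h` is a maximal predicate commuting with `r` such that `l h ≤ r`. The bound survives suprema
  -- because multiplication by `l` is the sequential product with a scalar, which is normal.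
  obtain ⟨h, ⟨hrh, hlr⟩, hmax⟩ := hφ.exists_maximal (SequentialEffectus.normal (C := C))
    (P := fun h => Comm r h ∧ l • φ h ≤ φ r) (a := 0)
    ⟨comm_of_sq_eq_zero (FinPAC.comp_zero _), by
      rw [hφ.map_zero, smul_zero]; exact hφ.nonneg r⟩
    (fun S s hS _ hP hs => ⟨Comm.sup hS hs fun x hx => (hP x hx).1, by
      rw [← hφ.scalar_sq h0.le h1 ht]
      refine hφ.isLUB_le ((sequential A).seq_sup t S s hS hs) (hφ.nonneg r) (hφ.le_ounit r) ?_
      rintro _ ⟨x, hx, rfl⟩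
      exact (hφ.scalar_sq h0.le h1 ht x).trans_le (hP x hx).2⟩)
  obtain ⟨v, hv⟩ := hφ.exists_eq (sub_nonneg.2 hlr)
    ((sub_le_self _ (smul_nonneg h0.le (hφ.nonneg h))).trans (hφ.le_ounit r))
  obtain ⟨k, hk⟩ := hφ.exists_smul h0.le h1 h
  rw [← hk] at hv
  have hck : ∀ {c : Pred A}, Comm c h → Comm c k := fun hc => hφ.comm_smul h0.le h1 hc hk
  set u := ortho h with hu
  have hrv : Comm r v := hφ.comm_sub (hck hrh) (Comm.refl r) hv
  have huv : Comm v u := (hφ.comm_sub (hck (Comm.refl h)) hrh.symm hv).symm.ortho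
  set x := sq u v with hx
  have hxu : φ x ≤ φ u := hφ.map_sq_le_left u v
  have hxv : φ x ≤ φ v := hφ.map_sq_le_right huv.symm
  obtain ⟨h', hh'⟩ := hφ.exists_eq (x := φ h + φ x) (add_nonneg (hφ.nonneg h) (hφ.nonneg x)) (by
    rw [hu, hφ.map_ortho] at hxu
    rwa [← le_sub_iff_add_le'])
  -- `l (h + x) ≤ l h + v = r`, so maximality of `h` leaves no room for `x`.
  have hx0 : x = 0 := by
    have h2 := hmax h' ⟨hφ.comm_add hrh (hrh.ortho.sq hrv) hh', by
      rw [hh', smul_add, ← hk, ← le_sub_iff_add_le', ← hv]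
      exact le_trans ((smul_le_smul_of_nonneg_right h1 (hφ.nonneg x)).trans (one_smul ℝ _).le)
        hxv⟩ (by rw [hh']; exact le_add_of_nonneg_right (hφ.nonneg x))
    rw [h2] at hh'
    rw [← hφ.map_eq_zero]
    simpa using hh'
  -- The cut is `e = f⊥`, which lies below `h`. On `f` the excess `v = r - l h` vanishes, so there
  -- `r` is at most `l`.
  obtain ⟨f, hf⟩ := exists_isCeil u
  have hvf : sq v f = 0 := hf.sq_eq_zero hx0
  have hfv : sq f v = 0 := sq_eq_zero_symm hvf
  have hfh : Comm f h := by
    have h2 : Comm f u := hf.isSharp.comm_of_le hf.le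
    have := h2.ortho
    rwa [hu, ortho_ortho] at this
  have hr : φ r = φ v + φ k := by rw [hv, sub_add_cancel]
  have hfr : Comm f r := hφ.comm_add (comm_of_sq_eq_zero hfv) (hck hfh) hr
  refine ⟨ortho f, hf.isSharp.ortho, hfr.symm.ortho.symm, ?_, ?_⟩
  · have h2 : φ (ortho f) ≤ φ h := by
      have h3 := hφ.le_iff.1 hf.le
      rw [hu, hφ.map_ortho] at h3
      rw [hφ.map_ortho]
      exact sub_le_comm.1 h3
    exact (smul_le_smul_of_nonneg_left h2 h0.le).trans hlr
  · rw [ortho_ortho, hφ.sq_add f hr, hfv, hφ.map_zero, zero_add, hφ.sq_smul f h0.le h1 hk]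
    exact smul_le_smul_of_nonneg_left (hφ.map_sq_le_left f h) h0.le

end IsUnitIntervalIso

/-! ### Functional calculus for two orthogonal idempotents -/

section PeirceOperators
variable {V : Type*} [NormedAddCommGroup V] [NormedSpace ℝ V]

/-- The operator with eigenvalues `a`, `b`, `c` on the Peirce components of `P` and `P'`. -/
noncomputable def peirce (P P' : V →L[ℝ] V) (a b c : ℝ) : V →L[ℝ] V :=
  a • P + b • P' + c • (1 - P - P')

theorem peirce_one (P P' : V →L[ℝ] V) : peirce P P' 1 1 1 = 1 := by
  simp only [peirce, one_smul]
  abel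

theorem peirce_mul {P P' : V →L[ℝ] V} (h1 : P * P = P) (h2 : P' * P' = P') (h3 : P * P' = 0)
    (h4 : P' * P = 0) (a b c a' b' c' : ℝ) :
    peirce P P' a b c * peirce P P' a' b' c' = peirce P P' (a * a') (b * b') (c * c') := by
  simp only [peirce, mul_add, add_mul, mul_sub, sub_mul, smul_mul_assoc, mul_smul_comm, h1, h2, h3,
    h4, mul_one, one_mul, smul_zero, sub_zero]
  module

theorem peirce_pow {P P' : V →L[ℝ] V} (h1 : P * P = P) (h2 : P' * P' = P') (h3 : P * P' = 0)
    (h4 : P' * P = 0) (a b c : ℝ) (n : ℕ) :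
    peirce P P' a b c ^ n = peirce P P' (a ^ n) (b ^ n) (c ^ n) := by
  induction n with
  | zero => simp [peirce_one]
  | succ n ih => rw [pow_succ, ih, peirce_mul h1 h2 h3 h4, pow_succ, pow_succ, pow_succ]

theorem hasSum_peirce_exp {P P' : V →L[ℝ] V} (h1 : P * P = P) (h2 : P' * P' = P')
    (h3 : P * P' = 0) (h4 : P' * P = 0) (t : ℝ) :
    HasSum (fun n : ℕ => ((n.factorial : ℝ)⁻¹) • (t • (P - P')) ^ n)
      (peirce P P' (Real.exp t) (Real.exp (-t)) 1) := by
  have h5 : t • (P - P') = peirce P P' t (-t) 0 := by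
    simp only [peirce]
    module
  have h6 : ∀ x : ℝ, HasSum (fun n : ℕ => (n.factorial : ℝ)⁻¹ * x ^ n) (Real.exp x) := fun x => by
    rw [Real.exp_eq_exp_ℝ]
    simpa [div_eq_inv_mul] using NormedSpace.expSeries_div_hasSum_exp x
  -- The third eigenvalue is `0`; with `0 ^ 0 = 1` its exponential series sums to `1`.
  have h7 := (((h6 t).smul_const P).add ((h6 (-t)).smul_const P')).add
    ((h6 0).smul_const (1 - P - P'))
  rw [Real.exp_zero] at h7
  refine h7.congr_fun fun n => ?_
  rw [h5, peirce_pow h1 h2 h3 h4, peirce, smul_add, smul_add, smul_smul, smul_smul, smul_smul]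

end PeirceOperators

/-! ### The corner identity, positivity of the resolvent and of the exponential -/

namespace IsUnitIntervalIso
open OrderUnitSpace SequentialEffectus
variable {C : Type u} [Category.{v} C] [HasFiniteCoproducts C] [Effectus C] [SequentialEffectus C]
  {conv : ConvexAction (Pred (Effectus.unit (C := C)))} {A : C} {V : Type w} [OrderUnitSpace V]
  {φ : Pred A → V}

/-- Expanding `e & p` in two ways, as `e & (p & e) + e & (p & e⊥)` and as `(e & p) & (e & p) + (e &
p) & (e & p⊥)`, and cancelling equal squares gives `e & (p & e⊥) = (e & p) & (e & p⊥)`. The right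
side is symmetric in `p` and `p⊥`. -/
theorem sq_sq_ortho_eq (hφ : IsUnitIntervalIso conv A φ) {p e : Pred A} (hp : IsSharp p)
    (he : IsSharp e) : sq e (sq p (ortho e)) = sq e (sq (ortho p) (ortho e)) := by
  have hone : ∀ x : Pred A, φ (truth A) = φ x + φ (ortho x) := fun x => by
    rw [hφ.map_ortho, hφ.map_truth, add_sub_cancel]
  have key : ∀ x y : Pred A, IsSharp x → φ e = φ (sq e x) + φ (sq e y) →
      φ (sq e (sq x (ortho e))) = φ (sq (sq e x) (sq e y)) := by
    intro x y hx hxy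
    have h1 : φ (sq e x) = φ (sq e (sq x e)) + φ (sq e (sq x (ortho e))) := by
      refine hφ.sq_add e ?_
      rw [← hφ.sq_add x (hone e), sq_truth]
    have h2 : φ (sq e x) = φ (sq (sq e x) (sq e x)) + φ (sq (sq e x) (sq e y)) := by
      rw [← hφ.sq_add _ hxy, (he.sq_of_le (sq_le e x)).2]
    have h3 : sq (sq e x) (sq e x) = sq e (sq x e) := asrt_sq_of_isSharp hx
    rw [h3] at h2
    exact add_left_cancel (h1.symm.trans h2)
  have h1 : φ e = φ (sq e p) + φ (sq e (ortho p)) := by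
    rw [← hφ.sq_add e (hone p), sq_truth]
  -- The two predicates add up to `e`, which commutes with everything below it.
  have hc : Comm (sq e p) (sq e (ortho p)) :=
    hφ.comm_sub (Comm.refl _) (he.comm_of_le (sq_le e p)).symm (by rw [h1, add_sub_cancel_left])
  refine hφ.injective ?_
  rw [key p (ortho p) hp h1, key (ortho p) p hp.ortho (by rw [h1, add_comm]),
    show sq (sq e p) _ = _ from hc]

/-- The off-diagonal corners of `asrt_p - asrt_{p⊥}` with respect to a sharp predicate vanish. -/
theorem sq_sq_eq_of_le_ortho (hφ : IsUnitIntervalIso conv A φ) {p e z : Pred A} (hp : IsSharp p)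
    (he : IsSharp e) (hz : z ≤ ortho e) : sq e (sq p z) = sq e (sq (ortho p) z) := by
  refine hφ.sharp_induction (P := fun z => sq e (sq p z) = sq e (sq (ortho p) z)) z ?_ ?_ ?_ ?_
  · simp only [sq, FinPAC.comp_zero]
  · intro q d μ hq hμ hμ1 hd hdz
    -- `d ≤ z ≤ e⊥`, so `e` annihilates `d` and hence the sharp `q` itself.
    have h1 : sq e d = 0 := by
      refine pred_eq_zero_of_le ?_
      have h2 : sq e (ortho e) = 0 := sq_eq_self_iff.1 he.sq_self
      rw [← h2]
      exact sq_mono e (hφ.le_iff.2 (hdz.trans (hφ.le_iff.1 hz)))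
    have h2 : sq e q = 0 := by
      have h3 := hφ.sq_smul e hμ.le hμ1 hd
      rw [h1, hφ.map_zero, eq_comm, smul_eq_zero_iff_right hμ.ne', hφ.map_eq_zero] at h3
      exact h3
    have h3 : sq e (ortho q) = e := sq_eq_self_iff.2 (by rwa [ortho_ortho])
    have h4 : Comm e (ortho q) := (comm_of_sq_eq_zero h2).ortho
    -- As `e` absorbs `q⊥`, the claim reduces to the corner identity for the complementary pair
    -- `q⊥`, `q`.
    have h5 : ∀ c, sq e c = sq e (sq (ortho q) c) := fun c => by
      have h6 := (sequential A).seq_assoc e (ortho q) h4 c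
      change sq e (sq (ortho q) c) = sq (sq e (ortho q)) c at h6
      rw [h6, h3]
    have h6 := hφ.sq_sq_ortho_eq hp hq.ortho
    rw [ortho_ortho] at h6
    have h7 : sq e (sq p q) = sq e (sq (ortho p) q) := by rw [h5, h6, ← h5]
    refine hφ.injective ?_
    rw [hφ.sq_smul e hμ.le hμ1 (hφ.sq_smul p hμ.le hμ1 hd),
      hφ.sq_smul e hμ.le hμ1 (hφ.sq_smul (ortho p) hμ.le hμ1 hd), h7]
  · intro b c d hb hc hd
    refine hφ.injective ?_
    rw [hφ.sq_add e (hφ.sq_add p hd), hφ.sq_add e (hφ.sq_add (ortho p) hd), hb, hc]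
  · intro S s hS _ hP hs
    have h1 := (SequentialEffectus.normal (C := C)).scott (asrt e ≫ asrt p) S s hS hs
    have h2 := (SequentialEffectus.normal (C := C)).scott (asrt e ≫ asrt (ortho p)) S s hS hs
    have h3 : (fun q : Pred A => ((asrt e ≫ asrt p) ≫ q : Pred A)) '' S =
        (fun q : Pred A => ((asrt e ≫ asrt (ortho p)) ≫ q : Pred A)) '' S := by
      refine Set.image_congr fun x hx => ?_
      rw [Category.assoc, Category.assoc]
      exact hP x hx
    rw [h3] at h1
    have h4 := pred_le_antisymm (h1.2 h2.1) (h2.2 h1.1)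
    rw [Category.assoc, Category.assoc] at h4
    exact h4

/-- `1 - t (asrt_p - asrt_{p⊥})` reflects positivity for small `t`. -/
theorem nonneg_of_smul_le (hφ : IsUnitIntervalIso conv A φ) {p : Pred A} (hp : IsSharp p)
    {t : ℝ} (h0 : 0 < t) (h1 : t < 1) {x : V}
    (hx : t • (hφ.op (asrt p) x - hφ.op (asrt (ortho p)) x) ≤ x) : 0 ≤ x := by
  by_contra hneg
  have hu0 : (0 : V) ≤ ounit := ounit_nonneg
  -- `m = inf M` is the least shift making `x` positive; it is attained because the cone is closed.
  set M : Set ℝ := {r | 0 ≤ r ∧ 0 ≤ x + r • (ounit : V)} with hM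
  have hMne : M.Nonempty := ⟨‖x‖, norm_nonneg x, by
    rw [← neg_le_iff_add_nonneg]
    exact neg_norm_smul_le x⟩
  have hMb : BddBelow M := ⟨0, fun r hr => hr.1⟩
  set m := sInf M with hm
  have hm0 : 0 ≤ m := le_csInf hMne fun r hr => hr.1
  have hy0 : 0 ≤ x + m • (ounit : V) := by
    rw [← neg_le_iff_add_nonneg', neg_le]
    refine neg_le.1 (le_of_forall_pos fun ε hε => ?_)
    obtain ⟨r, hr, hlt⟩ := exists_lt_of_csInf_lt hMne (lt_add_of_pos_right m hε)
    rw [← add_smul]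
    refine le_trans ?_ (smul_le_smul_of_nonneg_right hlt.le hu0)
    rw [neg_le_iff_add_nonneg']
    exact hr.2
  have hmpos : 0 < m := by
    refine hm0.lt_of_ne fun h => hneg ?_
    rwa [← h, zero_smul, add_zero] at hy0
  obtain ⟨N, y, hN, hy⟩ := hφ.exists_eq_smul_of_nonneg hy0
  -- The level `ε` is small enough for the final comparison of coefficients, and in particular gives
  -- `N ε < m`.
  obtain ⟨ε, hε0, hε1, hε⟩ : ∃ ε : ℝ, 0 < ε ∧ ε ≤ 1 ∧ N * ε * (1 + t) < m * (1 - t) := by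
    have hpos : 0 < m * (1 - t) / (2 * N * (1 + t)) :=
      div_pos (mul_pos hmpos (by linarith)) (by positivity)
    refine ⟨min 1 (m * (1 - t) / (2 * N * (1 + t))), lt_min one_pos hpos, min_le_left _ _, ?_⟩
    have h2 : N * min 1 (m * (1 - t) / (2 * N * (1 + t))) * (1 + t) ≤
        N * (m * (1 - t) / (2 * N * (1 + t))) * (1 + t) := by
      gcongr
      exact min_le_right _ _
    refine h2.trans_lt ?_
    have h3 : N * (m * (1 - t) / (2 * N * (1 + t))) * (1 + t) = m * (1 - t) / 2 := by
      field_simp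
    rw [h3]
    exact half_lt_self (mul_pos hmpos (by linarith))
  have hNε : 0 < N * ε := mul_pos hN hε0
  obtain ⟨e, he, hey, hle, hcut⟩ := hφ.exists_spectral_cut y hε0 hε1
  set f := ortho e with hf
  have hfs : IsSharp f := he.ortho
  have hfe : ortho f = e := ortho_ortho e
  -- If `f = 0` then `x + m 1 ≥ N ε 1`, so the smaller shift `m - N ε` would already do.
  have hf0 : f ≠ 0 := by
    intro h
    have h2 : φ e = ounit := by
      rw [← hfe, h, hφ.map_ortho, hφ.map_zero, sub_zero]
    rw [h2] at hle
    have h3 : (N * ε) • (ounit : V) ≤ x + m • ounit := by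
      rw [hy, mul_smul]
      exact smul_le_smul_of_nonneg_left hle hN.le
    have h4 : m - N * ε ∈ M := ⟨by nlinarith, by
      rw [sub_smul, ← add_sub_assoc, sub_nonneg]
      exact h3⟩
    have h5 := csInf_le hMb h4
    linarith
  have hysum : φ y = φ (sq e y) + φ (sq f y) := by
    have h2 : φ (truth A) = φ e + φ f := by rw [hf, hφ.map_ortho, hφ.map_truth, add_sub_cancel]
    have h3 := hφ.sq_add y h2
    rwa [sq_truth, ← show sq e y = sq y e from hey,
      show sq y f = sq f y from hey.symm.ortho] at h3
  set P := hφ.op (asrt p) with hP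
  set P' := hφ.op (asrt (ortho p)) with hP'
  set F := hφ.op (asrt f) with hF
  have hFs : ∀ q, F (φ q) = φ (sq f q) := hφ.op_apply _
  have hPs : ∀ q, P (φ q) = φ (sq p q) := hφ.op_apply _
  have hPs' : ∀ q, P' (φ q) = φ (sq (ortho p) q) := hφ.op_apply _
  have hF1 : F ounit = φ f := by rw [hF, hφ.op_ounit, asrt_truth]
  have hP1 : P ounit = φ p := by rw [hP, hφ.op_ounit, asrt_truth]
  have hP1' : P' ounit = φ (ortho p) := by rw [hP', hφ.op_ounit, asrt_truth]
  have hxy : x = N • (φ (sq e y) + φ (sq f y)) - m • ounit := by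
    rw [← hysum, ← hy, add_sub_cancel_right]
  -- The part of `y` under `e` contributes nothing to the compression of `D x` by `f`.
  have hcorner : F (P (φ (sq e y))) = F (P' (φ (sq e y))) := by
    rw [hPs, hPs', hFs, hFs, hφ.sq_sq_eq_of_le_ortho hp hfs]
    rw [hfe]
    exact sq_le e y
  have hfe0 : F (φ (sq e y)) = 0 := by
    rw [hFs, hφ.map_eq_zero]
    refine pred_eq_zero_of_le ?_
    rw [← he.sq_ortho_self]
    exact sq_mono f (sq_le e y)
  have hff : F (φ (sq f y)) = φ (sq f y) := by
    rw [hFs, (hfs.sq_of_le (sq_le f y)).1]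
  have hFx : F x ≤ (N * ε - m) • φ f := by
    rw [hxy, map_sub, map_smul, map_add, hfe0, hff, zero_add, map_smul, hF1, sub_smul, mul_smul]
    exact sub_le_sub_right (smul_le_smul_of_nonneg_left hcut hN.le) _
  have hbound : F (P' (φ (sq f y))) ≤ ε • φ f := by
    have h2 : φ (sq f y) ≤ ε • ounit :=
      hcut.trans (smul_le_smul_of_nonneg_left (hφ.le_ounit f) hε0.le)
    have h3 : P' (φ (sq f y)) ≤ ε • ounit := by
      refine (hφ.op_mono _ h2).trans ?_
      rw [map_smul, ← hP', hP1']
      exact smul_le_smul_of_nonneg_left (hφ.le_ounit _) hε0.le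
    refine (hφ.op_mono _ h3).trans ?_
    rw [map_smul, ← hF, hF1]
  have hFP : 0 ≤ F (P (φ (sq f y))) := hφ.op_nonneg _ (hφ.op_nonneg _ (hφ.nonneg _))
  have hFD1 : F (φ p) - F (φ (ortho p)) ≤ φ f := by
    rw [hFs, hFs]
    exact (sub_le_self _ (hφ.nonneg _)).trans (hφ.map_sq_le_left f p)
  have hFDx : F (P x - P' x) = N • (F (P (φ (sq f y))) - F (P' (φ (sq f y)))) -
      m • (F (φ p) - F (φ (ortho p))) := by
    rw [hxy]
    simp only [map_sub, map_smul, map_add, hP1, hP1', hcorner]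
    module
  have hlow : -((N * ε + m) • φ f) ≤ F (P x - P' x) := by
    rw [hFDx, add_smul, neg_add, ← sub_eq_add_neg, mul_smul, ← smul_neg]
    refine sub_le_sub (smul_le_smul_of_nonneg_left ?_ hN.le)
      (smul_le_smul_of_nonneg_left hFD1 hm0)
    rw [neg_le_sub_iff_le_add]
    exact hbound.trans (le_add_of_nonneg_left hFP)
  have h2 : t • F (P x - P' x) ≤ F x := by
    rw [← map_smul]
    exact hφ.op_mono _ hx
  -- The lower bound on `F (D x)` against the upper bound on `F x`: a strictly positive multiple of
  -- `φ f`, with coefficient `m (1 - t) - N ε (1 + t)`, would be nonpositive.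
  have h3 : t • -((N * ε + m) • φ f) ≤ (N * ε - m) • φ f :=
    (smul_le_smul_of_nonneg_left hlow h0.le).trans (h2.trans hFx)
  have h4 : 0 ≤ -((m * (1 - t) - N * ε * (1 + t)) • φ f) := by
    rw [← sub_nonneg] at h3
    convert h3 using 1
    module
  rw [← smul_neg] at h4
  have h5 := smul_le_smul_of_nonneg_left h4 (inv_nonneg.2 (sub_nonneg.2 hε.le))
  rw [smul_zero, smul_smul, inv_mul_cancel₀ (sub_pos.2 hε).ne', one_smul, neg_nonneg] at h5
  exact hf0 (hφ.map_eq_zero.1 (le_antisymm h5 (hφ.nonneg f)))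

omit [SequentialEffectus C] in
theorem op_mul (hφ : IsUnitIntervalIso conv A φ) (f g : A ⟶ A) :
    hφ.op f * hφ.op g = hφ.op (f ≫ g) := hφ.ext_linearMap fun p => by
  rw [mul_apply_eq_comp, hφ.op_apply, hφ.op_apply, hφ.op_apply, Category.assoc]

theorem op_asrt_mul_self (hφ : IsUnitIntervalIso conv A φ) {p : Pred A} (hp : IsSharp p) :
    hφ.op (asrt p) * hφ.op (asrt p) = hφ.op (asrt p) := by
  rw [hφ.op_mul, hp.asrt_comp_asrt]

theorem op_asrt_mul_ortho (hφ : IsUnitIntervalIso conv A φ) {p : Pred A} (hp : IsSharp p) :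
    hφ.op (asrt p) * hφ.op (asrt (ortho p)) = 0 := hφ.ext_linearMap fun q => by
  have h1 : sq p (ortho p) = 0 := sq_eq_self_iff.1 hp.sq_self
  have h2 := (sequential A).seq_assoc p (ortho p) (comm_of_sq_eq_zero h1) q
  change sq p (sq (ortho p) q) = sq (sq p (ortho p)) q at h2
  rw [hφ.op_mul, hφ.op_apply, Category.assoc]
  change φ (sq p (sq (ortho p) q)) = 0
  rw [h2, h1, hφ.map_eq_zero]
  exact pred_eq_zero_of_le (sq_le _ _)

theorem op_ortho_mul_asrt (hφ : IsUnitIntervalIso conv A φ) {p : Pred A} (hp : IsSharp p) :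
    hφ.op (asrt (ortho p)) * hφ.op (asrt p) = 0 := by
  have := hφ.op_asrt_mul_ortho hp.ortho
  rwa [ortho_ortho] at this

theorem peirce_exp_nonneg_of_pos (hφ : IsUnitIntervalIso conv A φ) {p : Pred A} (hp : IsSharp p)
    {t : ℝ} (ht : 0 < t) {v : V} (hv : 0 ≤ v) :
    0 ≤ peirce (hφ.op (asrt p)) (hφ.op (asrt (ortho p))) (Real.exp t) (Real.exp (-t)) 1 v := by
  set P := hφ.op (asrt p) with hP
  set P' := hφ.op (asrt (ortho p)) with hP'
  have h1 : P * P = P := hφ.op_asrt_mul_self hp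
  have h2 : P' * P' = P' := hφ.op_asrt_mul_self hp.ortho
  have h3 : P * P' = 0 := hφ.op_asrt_mul_ortho hp
  have h4 : P' * P = 0 := hφ.op_ortho_mul_asrt hp
  -- `(1 - s D)⁻¹` has eigenvalues `(1 - s)⁻¹`, `(1 + s)⁻¹`, `1`; its positivity is the minimum
  -- principle.
  have hres : ∀ s : ℝ, 0 < s → s < 1 → ∀ w : V, 0 ≤ w →
      0 ≤ peirce P P' (1 - s)⁻¹ (1 + s)⁻¹ 1 w := by
    intro s hs hs1 w hw
    refine hφ.nonneg_of_smul_le hp hs hs1 ?_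
    have h5 : peirce P P' (1 - s) (1 + s) 1 * peirce P P' (1 - s)⁻¹ (1 + s)⁻¹ 1 = 1 := by
      rw [peirce_mul h1 h2 h3 h4, mul_inv_cancel₀ (by linarith), mul_inv_cancel₀ (by linarith),
        one_mul, peirce_one]
    set z := peirce P P' (1 - s)⁻¹ (1 + s)⁻¹ 1 w with hz
    have h6 : peirce P P' (1 - s) (1 + s) 1 z = w := by
      rw [hz, ← mul_apply_eq_comp, h5, one_apply_eq_self]
    rw [← sub_nonneg]
    convert hw using 1
    rw [← h6]
    simp only [peirce, add_apply, smul_apply,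
      sub_apply, one_apply_eq_self]
    module
  have hpow : ∀ s : ℝ, 0 < s → s < 1 → ∀ n : ℕ,
      0 ≤ peirce P P' (((1 - s) ^ n)⁻¹) (((1 + s) ^ n)⁻¹) 1 v := by
    intro s hs hs1 n
    induction n with
    | zero => simpa [peirce_one] using hv
    | succ n ih =>
      have h5 := hres s hs hs1 _ ih
      rwa [← mul_apply_eq_comp, peirce_mul h1 h2 h3 h4, ← mul_inv, ← mul_inv,
        ← pow_succ', ← pow_succ', one_mul] at h5
  have hcont : Continuous fun ab : ℝ × ℝ => peirce P P' ab.1 ab.2 1 v := by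
    simp only [peirce, add_apply, smul_apply]
    fun_prop
  have hα : Filter.Tendsto (fun n : ℕ => ((1 - t / n) ^ n)⁻¹) Filter.atTop (nhds (Real.exp t)) := by
    have h5 := (Real.tendsto_one_add_div_pow_exp (-t)).inv₀ (Real.exp_pos _).ne'
    rw [← Real.exp_neg, neg_neg] at h5
    simpa [neg_div, ← sub_eq_add_neg] using h5
  have hβ : Filter.Tendsto (fun n : ℕ => ((1 + t / n) ^ n)⁻¹) Filter.atTop
      (nhds (Real.exp (-t))) := by
    have h5 := (Real.tendsto_one_add_div_pow_exp t).inv₀ (Real.exp_pos _).ne'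
    rwa [← Real.exp_neg] at h5
  have hlim := (hcont.tendsto (Real.exp t, Real.exp (-t))).comp (hα.prodMk_nhds hβ)
  -- Only `n > t` matter, for which the step `s = t / n` lies in `(0, 1)`.
  refine isClosed_nonneg.mem_of_tendsto hlim ?_
  filter_upwards [Filter.eventually_gt_atTop ⌈t⌉₊] with n hn
  have hn' : t < n := Nat.lt_of_ceil_lt hn
  exact hpow (t / n) (div_pos ht (ht.trans hn')) ((div_lt_one (ht.trans hn')).2 hn') n

theorem peirce_exp_nonneg (hφ : IsUnitIntervalIso conv A φ) {p : Pred A} (hp : IsSharp p)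
    (t : ℝ) {v : V} (hv : 0 ≤ v) :
    0 ≤ peirce (hφ.op (asrt p)) (hφ.op (asrt (ortho p))) (Real.exp t) (Real.exp (-t)) 1 v := by
  rcases lt_trichotomy t 0 with ht | rfl | ht
  · have h := hφ.peirce_exp_nonneg_of_pos hp.ortho (neg_pos.2 ht) hv
    rw [ortho_ortho, neg_neg] at h
    convert h using 2
    simp only [peirce]
    module
  · simpa [peirce_one] using hv
  · exact hφ.peirce_exp_nonneg_of_pos hp ht hv

/-- `asrt_p - asrt_{p⊥}` is an order derivation for sharp `p`. -/
theorem isOrderDerivation (hφ : IsUnitIntervalIso conv A φ) {p : Pred A} (hp : IsSharp p) :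
    IsOrderDerivation (hφ.op (asrt p) - hφ.op (asrt (ortho p))) := by
  intro t
  have h1 := hφ.op_asrt_mul_self hp
  have h2 := hφ.op_asrt_mul_self hp.ortho
  have h3 := hφ.op_asrt_mul_ortho hp
  have h4 := hφ.op_ortho_mul_asrt hp
  refine ⟨_, hasSum_peirce_exp h1 h2 h3 h4 t, ?_⟩
  set E : ℝ → V →L[ℝ] V := fun s =>
    peirce (hφ.op (asrt p)) (hφ.op (asrt (ortho p))) (Real.exp s) (Real.exp (-s)) 1 with hE
  have hinv : ∀ s x, E s (E (-s) x) = x := fun s x => by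
    rw [← mul_apply_eq_comp, hE]
    simp only
    rw [peirce_mul h1 h2 h3 h4, ← Real.exp_add, ← Real.exp_add, neg_neg, add_neg_cancel,
      neg_add_cancel, Real.exp_zero, one_mul, peirce_one, one_apply_eq_self]
  have hinv' : ∀ s x, E (-s) (E s x) = x := fun s x => by
    have := hinv (-s) x
    rwa [neg_neg] at this
  have hmono : ∀ s {x y : V}, x ≤ y → E s x ≤ E s y := fun s {x y} h => by
    rw [← sub_nonneg, ← map_sub]
    exact hφ.peirce_exp_nonneg hp s (sub_nonneg.2 h)
  refine ⟨{ toFun := E t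
            invFun := E (-t)
            left_inv := hinv' t
            right_inv := hinv t
            map_rel_iff' := fun {x y} => ⟨fun h => ?_, hmono t⟩ }, fun x => rfl⟩
  have := hmono (-t) (show E t x ≤ E t y from h)
  rwa [hinv', hinv'] at this

end IsUnitIntervalIso
end SeqEff

open SeqEff
theorem proposition4p14 {C : Type u} [Category.{v} C] [HasFiniteCoproducts C] [Effectus C]
    [SequentialEffectus C] (conv : ConvexAction (Pred (Effectus.unit (C := C)))) (A : C) :
    (∃ (V : Type v) (_ : OrderUnitSpace V) (φ : Pred A → V), IsUnitIntervalIso conv A φ) ∧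
    ∀ (V : Type w) [OrderUnitSpace V] (φ : Pred A → V), IsUnitIntervalIso conv A φ →
      ∀ p : Pred A, IsSharp p →
        (∃! S : V →L[ℝ] V, IsInduced φ (SequentialEffectus.asrt p) S) ∧
        (∃! T : V →L[ℝ] V, IsInduced φ (SequentialEffectus.asrt (ortho p)) T) ∧
        ∀ S T : V →L[ℝ] V,
          IsInduced φ (SequentialEffectus.asrt p) S →
          IsInduced φ (SequentialEffectus.asrt (ortho p)) T →
          IsOrderDerivation (S - T) := by
  refine ⟨exists_isUnitIntervalIso conv SequentialEffectus.normal A, fun V _ φ hφ p hp =>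
    ⟨hφ.existsUnique_isInduced _, hφ.existsUnique_isInduced _, fun S T hS hT => ?_⟩⟩
  rw [hφ.eq_op hS, hφ.eq_op hT]
  exact hφ.isOrderDerivation hp
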